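/- Let $(\mathcal V,\otimes,I)$ be a monoidal category which has equalizers and coequalizers, and whose tensor product preserves coequalizers in each variable (associativity and unit isomorphisms are suppressed, and an object also denotes its identity morphism). Let $\mathbb A=(A,e_A,m_A)$ be an algebra and $\mathbb C=(C,\varepsilon,\delta)$ a coalgebra in $\mathcal V$. Let $\lambda:C\otimes A\to A\otimes C$ be an entwining structure, i.e. a morphism with $$\lambda(C\otimes e_A)=e_A\otimes C,\qquad \lambda(C\otimes m_A)=(m_A\otimes C)(A\otimes\lambda)(\lambda\otimes A),$$ $$(A\otimes\varepsilon)\lambda=\varepsilon\otimes A,\qquad (A\otimes\delta)\lambda=(\lambda\otimes C)(C\otimes\lambda)(\delta\otimes A),$$ and let $g:I\to C$ be group-like, i.e. $\varepsilon g=1_I$ and $\delta g=g\otimes g$. *Notation.* For an algebra $R$, $\mathcal V_R$ is the category of right $R$-modules and $-\otimes_R-$ is the tensor product over $R$, defined by coequalizers. The category $\mathcal V_A^C(\lambda)$ of entwined modules has as objects the triples $(M,\xi,\nu)$ with $(M,\xi:M\otimes A\to M)$ a right $A$-module and $(M,\nu:M\to M\otimes C)$ a right $C$-comodule such that $\nu\xi=(\xi\otimes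 C)(M\otimes\lambda)(\nu\otimes A)$; its morphisms are the morphisms of $\mathcal V$ compatible with $\xi$ and $\nu$. Put $g_A=\lambda(g\otimes A):A\to A\otimes C$, and let $i_A:A^C\to A$ be the equalizer of $g_A$ and $A\otimes g$, with the unique algebra structure on $A^C$ for which $i_A$ is a morphism of algebras. Restriction along $i_A$ makes $A$ a left $A^C$-module (and an $A^C$-$A$-bimodule), and there is a functor $$\bar F:\mathcal V_{A^C}\to\mathcal V_A^C(\lambda),\qquad X\mapsto (X\otimes_{A^C}A,\;X\otimes_{A^C}m_A,\;X\otimes_{A^C}g_A).$$ Let $(A\otimes C)_\lambda$ be the $A$-coring with underlying object $A\otimes C$, left action $m_A\otimes C$, right action $(m_A\otimes C)(A\otimes\lambda)$, counit $A\otimes\varepsilon$, and comultiplication $A\otimes\delta$ (using $(A\otimes C)\otimes_A(A\otimes C)\cong A\otimes C\otimes C$). Let $A\otimes_{A^C}A$ be the $A$-coring whose counit is induced by $m_A$ and whose comultiplication is $A\otimes_{A^C}i_A\otimes_{A^C}A$ (using $A\otimes_{A^C}A\cong A\otimes_{A^C}A^C\otimes_{A^C}A$ and $A\otimes_{A^C}A\otimes_{A^C}A\cong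 (A\otimes_{A^C}A)\otimes_A(A\otimes_{A^C}A)$). The morphism $(m_A\otimes C)(A\otimes g_A):A\otimes A\to A\otimes C$ induces a morphism of $A$-corings $$\mathrm{can}:A\otimes_{A^C}A\to(A\otimes C)_\lambda,$$ and $A$ is called $(\mathbb C,g)$-Galois if $\mathrm{can}$ is an isomorphism of $A$-corings. The object $C$ is called flat if $-\otimes C:\mathcal V\to\mathcal V$ preserves equalizers, and $A$ is called faithfully flat as a left $A^C$-module if the functor $-\otimes_{A^C}A:\mathcal V_{A^C}\to\mathcal V_A$ is conservative (reflects isomorphisms) and preserves equalizers. **Theorem 5.6.** If $C$ is flat, then the following are equivalent: (i) the functor $\bar F:\mathcal V_{A^C}\to\mathcal V_A^C(\lambda)$ is an equivalence of categories; (ii) $A$ is $(\mathbb C,g)$-Galois, and $A$ is faithfully flat as a left $A^C$-module. -/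

import Mathlib

open CategoryTheory MonoidalCategory Limits MonObj ComonObj

universe v u

namespace Entwining

variable {V : Type u} [Category.{v} V] [MonoidalCategory V]

theorem exchange_middle {X X' Y Y' Z W : V} (f : X ⟶ X') (g : Y ⟶ Y')
    (h : (X' ⊗ Y') ⊗ Z ⟶ W) :
    X ◁ g ▷ Z ≫ (α_ X Y' Z).inv ≫ f ▷ Y' ▷ Z ≫ h =
      (α_ X Y Z).inv ≫ f ▷ Y ▷ Z ≫ (α_ X' Y Z).hom ≫ X' ◁ g ▷ Z ≫ (α_ X' Y' Z).inv ≫ h := by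
  have h1 := congr((α_ X Y Z).inv ≫ $(whisker_exchange f g) ▷ Z ≫ h)
  simpa using h1

theorem exchange_inv {X Y X' Z Z' W : V} (f : X ⊗ Y ⟶ X') (g : Z ⟶ Z') (h : X' ⊗ Z' ⟶ W) :
    X ◁ Y ◁ g ≫ (α_ X Y Z').inv ≫ f ▷ Z' ≫ h = (α_ X Y Z).inv ≫ f ▷ Z ≫ X' ◁ g ≫ h := by
  rw [← whisker_exchange_assoc]
  simp

theorem exchange_inv₂ {X Y X' Z₁ Z₂ Z₁' Z₂' W : V} (f : X ⊗ Y ⟶ X')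
    (g : Z₁ ⊗ Z₂ ⟶ Z₁' ⊗ Z₂') (h : (X' ⊗ Z₁') ⊗ Z₂' ⟶ W) :
    X ◁ Y ◁ g ≫ (α_ X Y (Z₁' ⊗ Z₂')).inv ≫ (α_ (X ⊗ Y) Z₁' Z₂').inv ≫ f ▷ Z₁' ▷ Z₂' ≫ h =
      (α_ X Y (Z₁ ⊗ Z₂)).inv ≫ (α_ (X ⊗ Y) Z₁ Z₂).inv ≫ f ▷ Z₁ ▷ Z₂ ≫ (α_ X' Z₁ Z₂).hom ≫
        X' ◁ g ≫ (α_ X' Z₁' Z₂').inv ≫ h := by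
  have h1 := exchange_inv f g ((α_ X' Z₁' Z₂').inv ≫ h)
  simpa using h1

theorem mul_assoc_whisker (A : Mon V) (C : V) {W : V} (h : A.X ⊗ C ⟶ W) :
    A.X ◁ μ[A.X] ▷ C ≫ (α_ A.X A.X C).inv ≫ μ[A.X] ▷ C ≫ h =
      A.X ◁ (α_ A.X A.X C).hom ≫ (α_ A.X A.X (A.X ⊗ C)).inv ≫ (α_ (A.X ⊗ A.X) A.X C).inv ≫
        μ[A.X] ▷ A.X ▷ C ≫ μ[A.X] ▷ C ≫ h := by
  have h1 := congr($(MonObj.mul_assoc A.X) ▷ C ≫ h)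
  rw [comp_whiskerRight_assoc] at h1
  rw [h1]
  simp

theorem rightUnitor_inv_comp_tensor {X Y X' Y' : V} (f : X ⊗ 𝟙_ V ⟶ X') (g : Y ⟶ Y') :
    (((ρ_ X).inv ≫ f) ⊗ₘ g) = (ρ_ X).inv ▷ Y ≫ (f ⊗ₘ g) := by
  rw [← tensorHom_id, tensorHom_comp_tensorHom, Category.id_comp]

theorem tensor_leftUnitor_inv_comp {X Y X' Y' : V} (f : X ⟶ X') (g : 𝟙_ V ⊗ Y ⟶ Y') :
    (f ⊗ₘ ((λ_ Y).inv ≫ g)) = X ◁ (λ_ Y).inv ≫ (f ⊗ₘ g) := by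
  rw [← id_tensorHom, tensorHom_comp_tensorHom, Category.id_comp]

/-- A right module over an algebra (monoid object) `A` of a monoidal category. -/
structure RightMod (A : Mon V) where
  /-- The underlying object. -/
  X : V
  /-- The right action. -/
  act : X ⊗ A.X ⟶ X
  act_one : X ◁ η[A.X] ≫ act = (ρ_ X).hom
  act_mul : X ◁ μ[A.X] ≫ act = (α_ X A.X A.X).inv ≫ act ▷ A.X ≫ act

namespace RightMod

variable {A : Mon V}

/-- A morphism of right modules. -/
@[ext]
structure Hom (M N : RightMod A) where
  /-- The underlying morphism. -/
  hom : M.X ⟶ N.X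
  act_hom : M.act ≫ hom = hom ▷ A.X ≫ N.act

instance : Category (RightMod A) where
  Hom M N := Hom M N
  id M := { hom := 𝟙 M.X, act_hom := by simp }
  comp f g :=
    { hom := f.hom ≫ g.hom
      act_hom := by
        rw [← Category.assoc, f.act_hom, Category.assoc, g.act_hom, comp_whiskerRight,
          Category.assoc] }
  id_comp f := by ext; simp
  comp_id f := by ext; simp
  assoc f g h := by ext; simp

@[ext]
theorem hom_ext {M N : RightMod A} (f g : M ⟶ N) (h : f.hom = g.hom) : f = g :=
  Hom.ext h

@[simp]
theorem id_hom (M : RightMod A) : Hom.hom (𝟙 M) = 𝟙 M.X := rfl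

@[simp]
theorem comp_hom {M N K : RightMod A} (f : M ⟶ N) (g : N ⟶ K) :
    Hom.hom (f ≫ g) = f.hom ≫ g.hom := rfl

/-- The right module underlying a bimodule. -/
@[simps]
abbrev ofBimod {R S : Mon V} (P : Bimod R S) : RightMod S where
  X := P.X
  act := P.actRight
  act_one := P.actRight_one
  act_mul := P.right_assoc

/-- The morphism of right modules underlying a morphism of bimodules. -/
abbrev ofBimodMap {R S : Mon V} {P Q : Bimod R S} (f : P ⟶ Q) : ofBimod P ⟶ ofBimod Q :=
  Hom.mk (M := ofBimod P) (N := ofBimod Q) f.hom f.right_act_hom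

end RightMod

section RelativeTensor

variable [HasCoequalizers V]
variable {R S T U : Mon V}

/-- The relative tensor product `M ⊗_R P` of a right `R`-module and an `R`-`S`-bimodule:
the coequalizer of the two maps `M ⊗ R ⊗ P ⟶ M ⊗ P` given by the two actions of `R`. -/
noncomputable def relTensor (M : RightMod R) (P : Bimod R S) : V :=
  coequalizer (M.act ▷ P.X) ((α_ M.X R.X P.X).hom ≫ M.X ◁ P.actLeft)

/-- The canonical morphism `M ⊗ P ⟶ M ⊗_R P`. -/
noncomputable def relπ (M : RightMod R) (P : Bimod R S) : M.X ⊗ P.X ⟶ relTensor M P :=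
  coequalizer.π _ _

theorem relπ_condition (M : RightMod R) (P : Bimod R S) :
    M.act ▷ P.X ≫ relπ M P = (α_ M.X R.X P.X).hom ≫ M.X ◁ P.actLeft ≫ relπ M P := by
  have h := coequalizer.condition (M.act ▷ P.X) ((α_ M.X R.X P.X).hom ≫ M.X ◁ P.actLeft)
  rw [Category.assoc] at h
  exact h

/-- The morphism out of `M ⊗_R P` induced by an `R`-balanced morphism out of `M ⊗ P`. -/
noncomputable def relDesc (M : RightMod R) (P : Bimod R S) {W : V} (k : M.X ⊗ P.X ⟶ W)
    (hk : M.act ▷ P.X ≫ k = (α_ M.X R.X P.X).hom ≫ M.X ◁ P.actLeft ≫ k) : relTensor M P ⟶ W :=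
  coequalizer.desc k (by rw [hk, Category.assoc])

@[simp]
theorem relπ_desc (M : RightMod R) (P : Bimod R S) {W : V} (k : M.X ⊗ P.X ⟶ W)
    (hk : M.act ▷ P.X ≫ k = (α_ M.X R.X P.X).hom ≫ M.X ◁ P.actLeft ≫ k) :
    relπ M P ≫ relDesc M P k hk = k :=
  coequalizer.π_desc _ _

@[simp]
theorem relπ_desc_assoc (M : RightMod R) (P : Bimod R S) {W : V} (k : M.X ⊗ P.X ⟶ W)
    (hk : M.act ▷ P.X ≫ k = (α_ M.X R.X P.X).hom ≫ M.X ◁ P.actLeft ≫ k) {Z : V} (h : W ⟶ Z) :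
    relπ M P ≫ relDesc M P k hk ≫ h = k ≫ h := by
  rw [← Category.assoc, relπ_desc]

theorem rel_ext {M : RightMod R} {P : Bimod R S} {W : V} {f g : relTensor M P ⟶ W}
    (h : relπ M P ≫ f = relπ M P ≫ g) : f = g :=
  coequalizer.hom_ext h

/-- Functoriality of the relative tensor product in both variables. -/
noncomputable def relMap {M N : RightMod R} {P Q : Bimod R S} (f : M ⟶ N) (g : P ⟶ Q) :
    relTensor M P ⟶ relTensor N Q :=
  relDesc M P ((f.hom ⊗ₘ g.hom) ≫ relπ N Q) (by
    have h1 := f.act_hom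
    have h2 := g.left_act_hom
    rw [MonoidalCategory.tensorHom_def', Category.assoc, ← whisker_exchange_assoc, ← comp_whiskerRight_assoc, h1,
      comp_whiskerRight_assoc, relπ_condition]
    have h3 := congr((α_ _ _ _).hom ≫ M.X ◁ $h2 ≫ f.hom ▷ _ ≫ relπ N Q)
    simp only [MonoidalCategory.whiskerLeft_comp, Category.assoc] at h3
    rw [h3]
    simp [whisker_exchange_assoc])

@[simp]
theorem relπ_map {M N : RightMod R} {P Q : Bimod R S} (f : M ⟶ N) (g : P ⟶ Q) :
    relπ M P ≫ relMap f g = (f.hom ⊗ₘ g.hom) ≫ relπ N Q :=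
  relπ_desc _ _ _ _

@[simp]
theorem relπ_map_assoc {M N : RightMod R} {P Q : Bimod R S} (f : M ⟶ N) (g : P ⟶ Q) {Z : V}
    (h : relTensor N Q ⟶ Z) :
    relπ M P ≫ relMap f g ≫ h = (f.hom ⊗ₘ g.hom) ≫ relπ N Q ≫ h := by
  rw [← Category.assoc, relπ_map, Category.assoc]

theorem relMap_id (M : RightMod R) (P : Bimod R S) : relMap (𝟙 M) (𝟙 P) = 𝟙 (relTensor M P) := by
  apply rel_ext
  rw [relπ_map, RightMod.id_hom, Bimod.id_hom', id_tensorHom_id, Category.id_comp,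
    Category.comp_id]

theorem relMap_comp {M N K : RightMod R} {P Q L : Bimod R S} (f : M ⟶ N) (f' : N ⟶ K)
    (g : P ⟶ Q) (g' : Q ⟶ L) : relMap (f ≫ f') (g ≫ g') = relMap f g ≫ relMap f' g' := by
  apply rel_ext
  rw [relπ_map, relπ_map_assoc, relπ_map, RightMod.comp_hom, Bimod.comp_hom',
    ← tensorHom_comp_tensorHom, Category.assoc]

end RelativeTensor
section Tensor

variable [HasCoequalizers V]
variable [∀ X : V, PreservesColimitsOfShape WalkingParallelPair (tensorRight X)]
variable {R S T U : Mon V}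

instance relπ_whiskerRight_epi (M : RightMod R) (P : Bimod R S) (Z : V) :
    Epi (relπ M P ▷ Z) :=
  inferInstanceAs (Epi ((tensorRight Z).map (coequalizer.π _ _)))

/-- The morphism out of `(M ⊗_R P) ⊗ Z` induced by a balanced morphism. -/
noncomputable def relDescRight (M : RightMod R) (P : Bimod R S) (Z : V) {W : V}
    (k : (M.X ⊗ P.X) ⊗ Z ⟶ W)
    (hk : M.act ▷ P.X ▷ Z ≫ k = (α_ M.X R.X P.X).hom ▷ Z ≫ (M.X ◁ P.actLeft) ▷ Z ≫ k) :
    relTensor M P ⊗ Z ⟶ W :=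
  (PreservesCoequalizer.iso (tensorRight Z) _ _).inv ≫ coequalizer.desc k (by
    simpa using hk)

@[simp]
theorem relπ_descRight (M : RightMod R) (P : Bimod R S) (Z : V) {W : V}
    (k : (M.X ⊗ P.X) ⊗ Z ⟶ W)
    (hk : M.act ▷ P.X ▷ Z ≫ k = (α_ M.X R.X P.X).hom ▷ Z ≫ (M.X ◁ P.actLeft) ▷ Z ≫ k) :
    relπ M P ▷ Z ≫ relDescRight M P Z k hk = k :=
  map_π_preserves_coequalizer_inv_desc (tensorRight Z) _ _ _ _

/-- The right action on `M ⊗_R P` coming from the right action on `P`. -/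
noncomputable def relActRight (M : RightMod R) (P : Bimod R S) :
    relTensor M P ⊗ S.X ⟶ relTensor M P :=
  relDescRight M P S.X ((α_ M.X P.X S.X).hom ≫ M.X ◁ P.actRight ≫ relπ M P) (by
    have h := P.middle_assoc
    rw [associator_naturality_left_assoc, ← whisker_exchange_assoc, relπ_condition,
      associator_naturality_middle_assoc, ← MonoidalCategory.whiskerLeft_comp_assoc M.X (_ ▷ _), h]
    simp)

@[simp]
theorem relπ_actRight (M : RightMod R) (P : Bimod R S) :
    relπ M P ▷ S.X ≫ relActRight M P = (α_ M.X P.X S.X).hom ≫ M.X ◁ P.actRight ≫ relπ M P :=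
  relπ_descRight _ _ _ _ _

@[simp]
theorem relπ_actRight_assoc (M : RightMod R) (P : Bimod R S) {Z : V} (h : relTensor M P ⟶ Z) :
    relπ M P ▷ S.X ≫ relActRight M P ≫ h =
      (α_ M.X P.X S.X).hom ≫ M.X ◁ P.actRight ≫ relπ M P ≫ h := by
  rw [← Category.assoc, relπ_actRight, Category.assoc, Category.assoc]

theorem relActRight_one (M : RightMod R) (P : Bimod R S) :
    relTensor M P ◁ η[S.X] ≫ relActRight M P = (ρ_ (relTensor M P)).hom := by
  rw [← cancel_epi (relπ M P ▷ 𝟙_ V), ← whisker_exchange_assoc, relπ_actRight,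
    associator_naturality_right_assoc, ← MonoidalCategory.whiskerLeft_comp_assoc, P.actRight_one]
  simp

theorem relActRight_mul (M : RightMod R) (P : Bimod R S) :
    relTensor M P ◁ μ[S.X] ≫ relActRight M P =
      (α_ (relTensor M P) S.X S.X).inv ≫ relActRight M P ▷ S.X ≫ relActRight M P := by
  rw [← cancel_epi (relπ M P ▷ (S.X ⊗ S.X)), ← whisker_exchange_assoc, relπ_actRight,
    associator_naturality_right_assoc, ← MonoidalCategory.whiskerLeft_comp_assoc,
    P.right_assoc, associator_inv_naturality_left_assoc, ← comp_whiskerRight_assoc,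
    relπ_actRight]
  simp

theorem relMap_actRight {M N : RightMod R} {P Q : Bimod R S} (f : M ⟶ N) (g : P ⟶ Q) :
    relActRight M P ≫ relMap f g = relMap f g ▷ S.X ≫ relActRight N Q := by
  have h := g.right_act_hom
  rw [← cancel_epi (relπ M P ▷ S.X), relπ_actRight_assoc, relπ_map, ← comp_whiskerRight_assoc,
    relπ_map, comp_whiskerRight_assoc, relπ_actRight, MonoidalCategory.tensorHom_def, Category.assoc,
    ← whisker_exchange_assoc, ← MonoidalCategory.whiskerLeft_comp_assoc, h]
  simp [whisker_exchange_assoc, exchange_middle]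

/-- The right `S`-module `M ⊗_R P`. -/
@[simps]
noncomputable abbrev relMod (M : RightMod R) (P : Bimod R S) : RightMod S where
  X := relTensor M P
  act := relActRight M P
  act_one := relActRight_one M P
  act_mul := relActRight_mul M P

/-- The functor `- ⊗_R P` from right `R`-modules to right `S`-modules,
for an `R`-`S`-bimodule `P`. -/
@[simps]
noncomputable def relFunctor (P : Bimod R S) : RightMod R ⥤ RightMod S where
  obj M := relMod M P
  map f := { hom := relMap f (𝟙 P), act_hom := relMap_actRight f (𝟙 P) }
  map_id M := RightMod.hom_ext _ _ (relMap_id M P)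
  map_comp f g := RightMod.hom_ext _ _ (by
    have h := relMap_comp f g (𝟙 P) (𝟙 P)
    rwa [Category.comp_id] at h)

/-- A bimodule `P` is flat as a left `R`-module if `- ⊗_R P : V_R ⥤ V_S` preserves equalizers. -/
def IsLeftFlat (P : Bimod R S) : Prop :=
  PreservesLimitsOfShape WalkingParallelPair (relFunctor P)

/-- A bimodule `P` is faithfully flat as a left `R`-module if `- ⊗_R P : V_R ⥤ V_S` is
conservative and preserves equalizers. -/
def IsLeftFaithfullyFlat (P : Bimod R S) : Prop :=
  (relFunctor P).ReflectsIsomorphisms ∧ IsLeftFlat P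

end Tensor

section LeftWhisker

variable [HasCoequalizers V]
variable {R S T : Mon V}

/-- The unit isomorphism `A ⊗_A P ⟶ P`, in the forward direction. -/
noncomputable def relLeftUnit (P : Bimod R S) : relTensor (.ofBimod (Bimod.regular R)) P ⟶ P.X :=
  relDesc _ P P.actLeft P.left_assoc

/-- The unit isomorphism `M ⊗_A A ⟶ M`, in the forward direction. -/
noncomputable def relRightUnit (M : RightMod R) : relTensor M (Bimod.regular R) ⟶ M.X :=
  relDesc M _ M.act (by
    have h := M.act_mul
    exact (congr((α_ M.X R.X R.X).hom ≫ $h).trans (by simp; rfl)).symm)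

@[simp]
theorem relπ_leftUnit (P : Bimod R S) :
    relπ (.ofBimod (Bimod.regular R)) P ≫ relLeftUnit P = P.actLeft :=
  relπ_desc _ _ _ _

@[simp]
theorem relπ_rightUnit (M : RightMod R) : relπ M (Bimod.regular R) ≫ relRightUnit M = M.act :=
  relπ_desc _ _ _ _

variable [∀ X : V, PreservesColimitsOfShape WalkingParallelPair (tensorLeft X)]

instance relπ_whiskerLeft_epi (M : RightMod R) (P : Bimod R S) (Z : V) :
    Epi (Z ◁ relπ M P) :=
  inferInstanceAs (Epi ((tensorLeft Z).map (coequalizer.π _ _)))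

/-- The morphism out of `Z ⊗ (M ⊗_R P)` induced by a balanced morphism. -/
noncomputable def relDescLeft (M : RightMod R) (P : Bimod R S) (Z : V) {W : V}
    (k : Z ⊗ (M.X ⊗ P.X) ⟶ W)
    (hk : Z ◁ M.act ▷ P.X ≫ k = Z ◁ (α_ M.X R.X P.X).hom ≫ Z ◁ M.X ◁ P.actLeft ≫ k) :
    Z ⊗ relTensor M P ⟶ W :=
  (PreservesCoequalizer.iso (tensorLeft Z) _ _).inv ≫ coequalizer.desc k (by
    simpa using hk)

@[simp]
theorem relπ_descLeft (M : RightMod R) (P : Bimod R S) (Z : V) {W : V}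
    (k : Z ⊗ (M.X ⊗ P.X) ⟶ W)
    (hk : Z ◁ M.act ▷ P.X ≫ k = Z ◁ (α_ M.X R.X P.X).hom ≫ Z ◁ M.X ◁ P.actLeft ≫ k) :
    Z ◁ relπ M P ≫ relDescLeft M P Z k hk = k :=
  map_π_preserves_coequalizer_inv_desc (tensorLeft Z) _ _ _ _

/-- The left action on `M ⊗_R P` coming from the left action on a bimodule `M`. -/
noncomputable def relActLeft (M : Bimod T R) (P : Bimod R S) :
    T.X ⊗ relTensor (.ofBimod M) P ⟶ relTensor (.ofBimod M) P :=
  relDescLeft (.ofBimod M) P T.X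
    ((α_ T.X M.X P.X).inv ≫ M.actLeft ▷ P.X ≫ relπ (.ofBimod M) P) (by
    have h := M.middle_assoc
    have h2 := relπ_condition (.ofBimod M) P
    rw [associator_inv_naturality_middle_assoc, associator_inv_naturality_right_assoc,
      whisker_exchange_assoc]
    have h3 := congr((α_ _ _ _).inv ▷ _ ≫ $h ▷ P.X ≫ relπ (.ofBimod M) P)
    simp only [comp_whiskerRight, Category.assoc, inv_hom_whiskerRight_assoc, h2] at h3
    exact (congr((α_ T.X (M.X ⊗ R.X) P.X).inv ≫ $(h3.symm))).trans (by simp))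

@[simp]
theorem relπ_actLeft (M : Bimod T R) (P : Bimod R S) :
    T.X ◁ relπ (.ofBimod M) P ≫ relActLeft M P =
      (α_ T.X M.X P.X).inv ≫ M.actLeft ▷ P.X ≫ relπ (.ofBimod M) P :=
  relπ_descLeft _ _ _ _ _

@[simp]
theorem relπ_actLeft_assoc (M : Bimod T R) (P : Bimod R S) {Z : V}
    (h : relTensor (.ofBimod M) P ⟶ Z) :
    T.X ◁ relπ (.ofBimod M) P ≫ relActLeft M P ≫ h =
      (α_ T.X M.X P.X).inv ≫ M.actLeft ▷ P.X ≫ relπ (.ofBimod M) P ≫ h := by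
  rw [← Category.assoc, relπ_actLeft, Category.assoc, Category.assoc]

theorem relActLeft_one (M : Bimod T R) (P : Bimod R S) :
    η[T.X] ▷ relTensor (.ofBimod M) P ≫ relActLeft M P =
      (λ_ (relTensor (.ofBimod M) P)).hom := by
  rw [← cancel_epi (𝟙_ V ◁ relπ (.ofBimod M) P), whisker_exchange_assoc, relπ_actLeft,
    associator_inv_naturality_left_assoc, ← comp_whiskerRight_assoc, M.one_actLeft]
  simp

theorem relActLeft_mul (M : Bimod T R) (P : Bimod R S) :
    μ[T.X] ▷ relTensor (.ofBimod M) P ≫ relActLeft M P =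
      (α_ T.X T.X (relTensor (.ofBimod M) P)).hom ≫ T.X ◁ relActLeft M P ≫ relActLeft M P := by
  rw [← cancel_epi ((T.X ⊗ T.X) ◁ relπ (.ofBimod M) P), whisker_exchange_assoc, relπ_actLeft,
    associator_inv_naturality_left_assoc, ← comp_whiskerRight_assoc, M.left_assoc,
    associator_naturality_right_assoc, ← MonoidalCategory.whiskerLeft_comp_assoc, relπ_actLeft]
  simp

theorem relMap_actLeft {M N : Bimod T R} {P Q : Bimod R S} (f : M ⟶ N) (g : P ⟶ Q) :
    relActLeft M P ≫ relMap (RightMod.ofBimodMap f) g =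
      T.X ◁ relMap (RightMod.ofBimodMap f) g ≫ relActLeft N Q := by
  have h := f.left_act_hom
  rw [← cancel_epi (T.X ◁ relπ (.ofBimod M) P), relπ_actLeft_assoc, relπ_map,
    ← MonoidalCategory.whiskerLeft_comp_assoc, relπ_map, MonoidalCategory.whiskerLeft_comp_assoc,
    relπ_actLeft, MonoidalCategory.tensorHom_def, Category.assoc,
    ← comp_whiskerRight_assoc]
  dsimp only [RightMod.ofBimodMap]
  rw [h]
  simp [exchange_inv]

end LeftWhisker

section BimoduleTensor

variable [HasCoequalizers V]
variable [∀ X : V, PreservesColimitsOfShape WalkingParallelPair (tensorLeft X)]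
variable [∀ X : V, PreservesColimitsOfShape WalkingParallelPair (tensorRight X)]
variable {R S T U : Mon V}


theorem relAct_middle (M : Bimod T R) (P : Bimod R S) :
    relActLeft M P ▷ S.X ≫ relActRight (.ofBimod M) P =
      (α_ T.X (relTensor (.ofBimod M) P) S.X).hom ≫
        T.X ◁ relActRight (.ofBimod M) P ≫ relActLeft M P := by
  have : Epi ((T.X ◁ relπ (.ofBimod M) P) ▷ S.X) :=
    inferInstanceAs (Epi ((tensorLeft T.X ⋙ tensorRight S.X).map (coequalizer.π _ _)))
  rw [← cancel_epi ((T.X ◁ relπ (.ofBimod M) P) ▷ S.X), ← comp_whiskerRight_assoc, relπ_actLeft,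
    associator_naturality_middle_assoc, ← MonoidalCategory.whiskerLeft_comp_assoc,
    relπ_actRight]
  simp [exchange_inv]

/-- The tensor product of bimodules, `M ⊗_R P`, with its left and right actions. -/
@[simps]
noncomputable abbrev relBimod (M : Bimod T R) (P : Bimod R S) : Bimod T S where
  X := relTensor (.ofBimod M) P
  actLeft := relActLeft M P
  one_actLeft := relActLeft_one M P
  left_assoc := relActLeft_mul M P
  actRight := relActRight (.ofBimod M) P
  actRight_one := relActRight_one (.ofBimod M) P
  right_assoc := relActRight_mul (.ofBimod M) P
  middle_assoc := relAct_middle M P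

/-- The tensor product of two morphisms of bimodules. -/
noncomputable abbrev relBimodMap {M N : Bimod T R} {P Q : Bimod R S} (f : M ⟶ N) (g : P ⟶ Q) :
    relBimod M P ⟶ relBimod N Q :=
  Bimod.Hom.mk (M := relBimod M P) (N := relBimod N Q) (relMap (RightMod.ofBimodMap f) g)
    (relMap_actLeft f g) (relMap_actRight (RightMod.ofBimodMap f) g)

/-- The associativity morphism `(M ⊗_R P) ⊗ Q ⟶ M ⊗_R (P ⊗_S Q)`. -/
noncomputable def relAssocAux (M : RightMod R) (P : Bimod R S) (Q : Bimod S T) :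
    relTensor M P ⊗ Q.X ⟶ relTensor M (relBimod P Q) :=
  relDescRight M P Q.X
    ((α_ M.X P.X Q.X).hom ≫ M.X ◁ relπ (.ofBimod P) Q ≫ relπ M (relBimod P Q)) (by
    have h := congr(M.X ◁ $(relπ_actLeft P Q) ≫ relπ M (relBimod P Q))
    have hc : M.act ▷ relTensor (.ofBimod P) Q ≫ relπ M (relBimod P Q) =
      (α_ M.X R.X (relTensor (.ofBimod P) Q)).hom ≫ M.X ◁ relActLeft P Q ≫
        relπ M (relBimod P Q) := relπ_condition M (relBimod P Q)
    rw [associator_naturality_left_assoc, ← whisker_exchange_assoc, hc]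
    simp only [MonoidalCategory.whiskerLeft_comp, Category.assoc] at h
    simp [h])

/-- The associativity morphism `(M ⊗_R P) ⊗_S Q ⟶ M ⊗_R (P ⊗_S Q)`. -/
noncomputable def relAssoc (M : RightMod R) (P : Bimod R S) (Q : Bimod S T) :
    relTensor (relMod M P) Q ⟶ relTensor M (relBimod P Q) :=
  relDesc (relMod M P) Q (relAssocAux M P Q) (by
    have h0 : relπ M P ▷ Q.X ≫ relAssocAux M P Q = _ := relπ_descRight _ _ _ _ _
    have : Epi (relπ M P ▷ S.X ▷ Q.X) := 
      inferInstanceAs (Epi ((tensorRight S.X ⋙ tensorRight Q.X).map (coequalizer.π _ _)))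
    rw [← cancel_epi (relπ M P ▷ S.X ▷ Q.X), ← comp_whiskerRight_assoc, relπ_actRight,
      associator_naturality_left_assoc, ← whisker_exchange_assoc]
    have h1 := congr((α_ _ _ _).hom ▷ Q.X ≫ (α_ _ _ _).hom ≫
      M.X ◁ $(relπ_condition (.ofBimod P) Q) ≫ relπ M (relBimod P Q))
    simp only [MonoidalCategory.whiskerLeft_comp, Category.assoc] at h1
    simp only [comp_whiskerRight, Category.assoc, h0, whisker_assoc, Iso.inv_hom_id_assoc]
    rw [h1]
    simp)

@[simp]
theorem relπ_assocAux (M : RightMod R) (P : Bimod R S) (Q : Bimod S T) :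
    relπ M P ▷ Q.X ≫ relAssocAux M P Q =
      (α_ M.X P.X Q.X).hom ≫ M.X ◁ relπ (.ofBimod P) Q ≫ relπ M (relBimod P Q) :=
  relπ_descRight _ _ _ _ _

@[simp]
theorem relπ_assoc (M : RightMod R) (P : Bimod R S) (Q : Bimod S T) :
    relπ (relMod M P) Q ≫ relAssoc M P Q = relAssocAux M P Q :=
  relπ_desc _ _ _ _

end BimoduleTensor
section Elements

variable [HasCoequalizers V]
variable {R S T U : Mon V}

theorem rel_balance (M : RightMod R) (P : Bimod R S) {X Y Z : V} (x : X ⟶ M.X) (r : Z ⟶ R.X)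
    (y : Y ⟶ P.X) :
    (((x ⊗ₘ r) ≫ M.act) ⊗ₘ y) ≫ relπ M P =
      (α_ X Z Y).hom ≫ (x ⊗ₘ ((r ⊗ₘ y) ≫ P.actLeft)) ≫ relπ M P := by
  have h : (((x ⊗ₘ r) ≫ M.act) ⊗ₘ y) = ((x ⊗ₘ r) ⊗ₘ y) ≫ M.act ▷ P.X := by
    rw [← tensorHom_id, tensorHom_comp_tensorHom, Category.comp_id]
  have h' : (x ⊗ₘ ((r ⊗ₘ y) ≫ P.actLeft)) = (x ⊗ₘ (r ⊗ₘ y)) ≫ M.X ◁ P.actLeft := by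
    rw [← id_tensorHom, tensorHom_comp_tensorHom, Category.comp_id]
  rw [h, h', Category.assoc, relπ_condition, Category.assoc, associator_naturality_assoc]

theorem rel_actLeft [∀ X : V, PreservesColimitsOfShape WalkingParallelPair (tensorLeft X)]
    (M : Bimod T R) (P : Bimod R S) {X Y Z : V} (r : Z ⟶ T.X) (x : X ⟶ M.X) (y : Y ⟶ P.X) :
    (r ⊗ₘ ((x ⊗ₘ y) ≫ relπ (.ofBimod M) P)) ≫ relActLeft M P =
      (α_ Z X Y).inv ≫ (((r ⊗ₘ x) ≫ M.actLeft) ⊗ₘ y) ≫ relπ (.ofBimod M) P := by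
  have h : (r ⊗ₘ ((x ⊗ₘ y) ≫ relπ (.ofBimod M) P)) =
      (r ⊗ₘ (x ⊗ₘ y)) ≫ T.X ◁ relπ (.ofBimod M) P := by
    rw [← id_tensorHom, tensorHom_comp_tensorHom, Category.comp_id]
  have h' : (((r ⊗ₘ x) ≫ M.actLeft) ⊗ₘ y) = ((r ⊗ₘ x) ⊗ₘ y) ≫ M.actLeft ▷ P.X := by
    rw [← tensorHom_id, tensorHom_comp_tensorHom, Category.comp_id]
  rw [h, h', Category.assoc, relπ_actLeft, Category.assoc, associator_inv_naturality_assoc]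

variable [∀ X : V, PreservesColimitsOfShape WalkingParallelPair (tensorRight X)]

theorem rel_actRight (M : RightMod R) (P : Bimod R S) {X Y Z : V} (x : X ⟶ M.X) (y : Y ⟶ P.X)
    (r : Z ⟶ S.X) :
    (((x ⊗ₘ y) ≫ relπ M P) ⊗ₘ r) ≫ relActRight M P =
      (α_ X Y Z).hom ≫ (x ⊗ₘ ((y ⊗ₘ r) ≫ P.actRight)) ≫ relπ M P := by
  have h : (((x ⊗ₘ y) ≫ relπ M P) ⊗ₘ r) = ((x ⊗ₘ y) ⊗ₘ r) ≫ relπ M P ▷ S.X := by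
    rw [← tensorHom_id, tensorHom_comp_tensorHom, Category.comp_id]
  have h' : (x ⊗ₘ ((y ⊗ₘ r) ≫ P.actRight)) = (x ⊗ₘ (y ⊗ₘ r)) ≫ M.X ◁ P.actRight := by
    rw [← id_tensorHom, tensorHom_comp_tensorHom, Category.comp_id]
  rw [h, h', Category.assoc, relπ_actRight, Category.assoc, associator_naturality_assoc]

theorem rel_assoc [∀ X : V, PreservesColimitsOfShape WalkingParallelPair (tensorLeft X)]
    (M : RightMod R) (P : Bimod R S) (Q : Bimod S T) {X Y Z : V} (x : X ⟶ M.X) (y : Y ⟶ P.X)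
    (z : Z ⟶ Q.X) :
    (((x ⊗ₘ y) ≫ relπ M P) ⊗ₘ z) ≫ relπ (relMod M P) Q ≫ relAssoc M P Q =
      (α_ X Y Z).hom ≫ (x ⊗ₘ ((y ⊗ₘ z) ≫ relπ (.ofBimod P) Q)) ≫ relπ M (relBimod P Q) := by
  have h : (((x ⊗ₘ y) ≫ relπ M P) ⊗ₘ z) = ((x ⊗ₘ y) ⊗ₘ z) ≫ relπ M P ▷ Q.X := by
    rw [← tensorHom_id, tensorHom_comp_tensorHom, Category.comp_id]
  have h' : (x ⊗ₘ ((y ⊗ₘ z) ≫ relπ (.ofBimod P) Q)) =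
      (x ⊗ₘ (y ⊗ₘ z)) ≫ M.X ◁ relπ (.ofBimod P) Q := by
    rw [← id_tensorHom, tensorHom_comp_tensorHom, Category.comp_id]
  rw [h, h', relπ_assoc, Category.assoc, relπ_assocAux, Category.assoc,
    associator_naturality_assoc]

end Elements

section Coring

variable [HasCoequalizers V]
variable [∀ X : V, PreservesColimitsOfShape WalkingParallelPair (tensorLeft X)]
variable [∀ X : V, PreservesColimitsOfShape WalkingParallelPair (tensorRight X)]

/-- An `A`-coring: a comonoid in the category of `A`-`A`-bimodules with the tensor product
over `A`. -/
structure Coring (A : Mon V) where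
  /-- The underlying bimodule. -/
  M : Bimod A A
  /-- The counit. -/
  counit : M ⟶ Bimod.regular A
  /-- The comultiplication. -/
  comul : M ⟶ relBimod M M
  counit_comul : comul.hom ≫ relMap (RightMod.ofBimodMap counit) (𝟙 M) ≫ relLeftUnit M = 𝟙 M.X
  comul_counit :
    comul.hom ≫ relMap (𝟙 (RightMod.ofBimod M)) counit ≫ relRightUnit (RightMod.ofBimod M) = 𝟙 M.X
  comul_assoc :
    comul.hom ≫ relMap (RightMod.ofBimodMap comul) (𝟙 M) ≫ relAssoc (RightMod.ofBimod M) M M =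
      comul.hom ≫ relMap (𝟙 (RightMod.ofBimod M)) comul

namespace Coring

variable {A : Mon V}

/-- A morphism of `A`-corings. -/
@[ext]
structure Hom (D E : Coring A) where
  /-- The underlying morphism of bimodules. -/
  hom : D.M ⟶ E.M
  counit_hom : hom ≫ E.counit = D.counit
  comul_hom : D.comul ≫ relBimodMap hom hom = hom ≫ E.comul

theorem relBimodMap_id (D : Bimod A A) : relBimodMap (𝟙 D) (𝟙 D) = 𝟙 (relBimod D D) :=
  Bimod.hom_ext _ _ (relMap_id _ _)

theorem relBimodMap_comp {D E F : Bimod A A} (f : D ⟶ E) (g : E ⟶ F) :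
    relBimodMap (f ≫ g) (f ≫ g) = relBimodMap f f ≫ relBimodMap g g :=
  Bimod.hom_ext _ _ (relMap_comp (RightMod.ofBimodMap f) (RightMod.ofBimodMap g) f g)

instance : Category (Coring A) where
  Hom D E := Hom D E
  id D :=
    { hom := 𝟙 D.M
      counit_hom := Category.id_comp _
      comul_hom := by rw [relBimodMap_id, Category.comp_id, Category.id_comp] }
  comp f g :=
    { hom := f.hom ≫ g.hom
      counit_hom := by rw [Category.assoc, g.counit_hom, f.counit_hom]
      comul_hom := by
        rw [relBimodMap_comp, ← Category.assoc, f.comul_hom, Category.assoc, g.comul_hom,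
          Category.assoc] }
  id_comp f := Hom.ext (Category.id_comp _)
  comp_id f := Hom.ext (Category.comp_id _)
  assoc f g h := Hom.ext (Category.assoc _ _ _)

end Coring

end Coring

/-- A morphism of algebras `i : B ⟶ A` makes `A` a `B`-`A`-bimodule. -/
@[simps]
abbrev restrictLeft {A B : Mon V} (i : B ⟶ A) : Bimod B A where
  X := A.X
  actLeft := i.hom ▷ A.X ≫ μ
  one_actLeft := by
    rw [← comp_whiskerRight_assoc, IsMonHom.one_hom, MonObj.one_mul]
  left_assoc := by
    rw [← comp_whiskerRight_assoc, IsMonHom.mul_hom]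
    simp [MonoidalCategory.tensorHom_def, whisker_exchange_assoc, exchange_middle]
  actRight := μ
  actRight_one := by simp
  right_assoc := by simp
  middle_assoc := by simp [whisker_exchange_assoc]

/-- A morphism of algebras `i : B ⟶ A` makes `A` an `A`-`B`-bimodule. -/
@[simps]
abbrev restrictRight {A B : Mon V} (i : B ⟶ A) : Bimod A B where
  X := A.X
  actLeft := μ
  one_actLeft := by simp
  left_assoc := by simp
  actRight := A.X ◁ i.hom ≫ μ
  actRight_one := by
    rw [← MonoidalCategory.whiskerLeft_comp_assoc, IsMonHom.one_hom, MonObj.mul_one]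
  right_assoc := by
    rw [← MonoidalCategory.whiskerLeft_comp_assoc, IsMonHom.mul_hom,
      MonoidalCategory.tensorHom_def]
    simp only [MonoidalCategory.whiskerLeft_comp, Category.assoc, MonObj.mul_assoc,
      comp_whiskerRight, whisker_assoc, ← whisker_exchange_assoc, tensor_whiskerLeft,
      Iso.inv_hom_id_assoc]
    rw [← MonoidalCategory.whiskerLeft_comp_assoc, whisker_exchange]
    simp
  middle_assoc := by
    simp [← whisker_exchange_assoc]

section Sweedler

variable [HasCoequalizers V]
variable [∀ X : V, PreservesColimitsOfShape WalkingParallelPair (tensorLeft X)]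
variable [∀ X : V, PreservesColimitsOfShape WalkingParallelPair (tensorRight X)]
variable {A B : Mon V} (i : B ⟶ A)

/-- The `A`-`A`-bimodule `A ⊗_B A` of a morphism of algebras `i : B ⟶ A`. -/
noncomputable abbrev sweedlerBimod : Bimod A A :=
  relBimod (restrictRight i) (restrictLeft i)

/-- The canonical morphism `A ⊗ A ⟶ A ⊗_B A`. -/
noncomputable def sweedlerπ : A.X ⊗ A.X ⟶ (sweedlerBimod i).X :=
  relπ (.ofBimod (restrictRight i)) (restrictLeft i)

theorem sweedlerπ_condition :
    A.X ◁ i.hom ▷ A.X ≫ A.X ◁ μ ≫ sweedlerπ i =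
      (α_ A.X B.X A.X).inv ≫ (A.X ◁ i.hom) ▷ A.X ≫ μ ▷ A.X ≫ sweedlerπ i := by
  have h := relπ_condition (.ofBimod (restrictRight i)) (restrictLeft i)
  have h' := congr((α_ A.X B.X A.X).inv ≫ $h)
  simp only [MonoidalCategory.whiskerLeft_comp, comp_whiskerRight, Category.assoc,
    Iso.inv_hom_id_assoc] at h'
  exact h'.symm

theorem sweedlerπ_actLeft :
    A.X ◁ sweedlerπ i ≫ (sweedlerBimod i).actLeft =
      (α_ A.X A.X A.X).inv ≫ μ ▷ A.X ≫ sweedlerπ i :=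
  relπ_actLeft _ _

theorem sweedlerπ_actRight :
    sweedlerπ i ▷ A.X ≫ (sweedlerBimod i).actRight =
      (α_ A.X A.X A.X).hom ≫ A.X ◁ μ ≫ sweedlerπ i :=
  relπ_actRight _ _

/-- The counit `A ⊗_B A ⟶ A`, `a ⊗ a' ↦ a a'`. -/
noncomputable def sweedlerCounit : (sweedlerBimod i).X ⟶ A.X :=
  relDesc (.ofBimod (restrictRight i)) (restrictLeft i) μ (by simp)

theorem sweedlerπ_counit : sweedlerπ i ≫ sweedlerCounit i = μ := relπ_desc _ _ _ _

/-- The morphism `A ⟶ A ⊗_B A`, `a ↦ a ⊗ 1`. -/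
noncomputable def sweedlerInl : A.X ⟶ (sweedlerBimod i).X :=
  (ρ_ A.X).inv ≫ A.X ◁ η ≫ sweedlerπ i

/-- The morphism `A ⟶ A ⊗_B A`, `a ↦ 1 ⊗ a`. -/
noncomputable def sweedlerInr : A.X ⟶ (sweedlerBimod i).X :=
  (λ_ A.X).inv ≫ η ▷ A.X ≫ sweedlerπ i

theorem sweedlerInl_actRight :
    sweedlerInl i ▷ A.X ≫ (sweedlerBimod i).actRight = sweedlerπ i := by
  rw [sweedlerInl, comp_whiskerRight, comp_whiskerRight, Category.assoc, Category.assoc,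
    sweedlerπ_actRight, associator_naturality_middle_assoc,
    ← MonoidalCategory.whiskerLeft_comp_assoc, MonObj.one_mul]
  simp

theorem sweedlerInr_actLeft :
    A.X ◁ sweedlerInr i ≫ (sweedlerBimod i).actLeft = sweedlerπ i := by
  rw [sweedlerInr, MonoidalCategory.whiskerLeft_comp, MonoidalCategory.whiskerLeft_comp,
    Category.assoc, Category.assoc, sweedlerπ_actLeft, associator_inv_naturality_middle_assoc,
    ← comp_whiskerRight_assoc, MonObj.mul_one]
  simp

theorem sweedlerInl_actLeft :
    A.X ◁ sweedlerInl i ≫ (sweedlerBimod i).actLeft = μ ≫ sweedlerInl i := by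
  rw [sweedlerInl, MonoidalCategory.whiskerLeft_comp, MonoidalCategory.whiskerLeft_comp,
    Category.assoc, Category.assoc, sweedlerπ_actLeft, associator_inv_naturality_right_assoc,
    whisker_exchange_assoc]
  simp

theorem sweedlerInr_actRight :
    sweedlerInr i ▷ A.X ≫ (sweedlerBimod i).actRight = μ ≫ sweedlerInr i := by
  rw [sweedlerInr, comp_whiskerRight, comp_whiskerRight, Category.assoc, Category.assoc,
    sweedlerπ_actRight, associator_naturality_left_assoc, ← whisker_exchange_assoc]
  simp

/-- `a i(b) ⊗ 1 = a ⊗ i(b)`. -/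
theorem sweedler_mul_inl :
    A.X ◁ i.hom ≫ μ ≫ sweedlerInl i = A.X ◁ i.hom ≫ sweedlerπ i := by
  have h : (α_ A.X B.X (𝟙_ V)).hom ≫ A.X ◁ B.X ◁ η ≫ A.X ◁ i.hom ▷ A.X ≫ A.X ◁ μ ≫ sweedlerπ i =
      (A.X ⊗ B.X) ◁ η ≫ (A.X ◁ i.hom) ▷ A.X ≫ μ ▷ A.X ≫ sweedlerπ i := by
    rw [sweedlerπ_condition]
    simp
  have h1 : B.X ◁ η[A.X] ≫ i.hom ▷ A.X ≫ μ = (ρ_ _).hom ≫ i.hom := by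
    rw [whisker_exchange_assoc, MonObj.mul_one, rightUnitor_naturality]
  rw [← MonoidalCategory.whiskerLeft_comp_assoc, ← MonoidalCategory.whiskerLeft_comp_assoc,
    Category.assoc, h1] at h
  rw [whisker_exchange_assoc, whisker_exchange_assoc] at h
  rw [sweedlerInl, ← cancel_epi (ρ_ (A.X ⊗ B.X)).hom]
  simp at h ⊢
  rw [h]

/-- `i(b) ⊗ a = 1 ⊗ i(b) a`. -/
theorem sweedler_mul_inr :
    i.hom ▷ A.X ≫ μ ≫ sweedlerInr i = i.hom ▷ A.X ≫ sweedlerπ i := by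
  have h : η ▷ (B.X ⊗ A.X) ≫ A.X ◁ i.hom ▷ A.X ≫ A.X ◁ μ ≫ sweedlerπ i =
      η ▷ (B.X ⊗ A.X) ≫ (α_ A.X B.X A.X).inv ≫ (A.X ◁ i.hom) ▷ A.X ≫ μ ▷ A.X ≫ sweedlerπ i := by
    rw [sweedlerπ_condition]
  have h1 : η[A.X] ▷ B.X ≫ A.X ◁ i.hom ≫ μ = (λ_ _).hom ≫ i.hom := by
    rw [← whisker_exchange_assoc, MonObj.one_mul, leftUnitor_naturality]
  rw [associator_inv_naturality_left_assoc, ← comp_whiskerRight_assoc,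
    ← comp_whiskerRight_assoc, Category.assoc, h1] at h
  rw [← whisker_exchange_assoc, ← whisker_exchange_assoc] at h
  rw [sweedlerInr, ← cancel_epi (λ_ (B.X ⊗ A.X)).hom]
  simp at h ⊢
  rw [h]

theorem sweedler_one_inl : η ≫ sweedlerInl i = η ≫ sweedlerInr i := by
  simp only [sweedlerInl, sweedlerInr]
  rw [rightUnitor_inv_naturality_assoc, leftUnitor_inv_naturality_assoc,
    ← whisker_exchange_assoc, unitors_inv_equal]

instance sweedlerπ_whiskerLeft_epi (Z : V) : Epi (Z ◁ sweedlerπ i) :=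
  relπ_whiskerLeft_epi _ _ _

instance sweedlerπ_whiskerRight_epi (Z : V) : Epi (sweedlerπ i ▷ Z) :=
  relπ_whiskerRight_epi _ _ _

theorem sweedlerInl_restrict :
    (A.X ◁ i.hom ≫ μ) ≫ sweedlerInl i = (sweedlerInl i ⊗ₘ i.hom) ≫ (sweedlerBimod i).actRight := by
  rw [Category.assoc, sweedler_mul_inl, ← sweedlerInl_actRight,
    MonoidalCategory.tensorHom_def', Category.assoc]

theorem sweedlerInr_restrict :
    (i.hom ▷ A.X ≫ μ) ≫ sweedlerInr i = (i.hom ⊗ₘ sweedlerInr i) ≫ (sweedlerBimod i).actLeft := by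
  rw [Category.assoc, sweedler_mul_inr, ← sweedlerInr_actLeft,
    MonoidalCategory.tensorHom_def, Category.assoc]

/-- The comultiplication `a ⊗ a' ↦ (a ⊗ 1) ⊗ (1 ⊗ a')` of `A ⊗_B A`. -/
noncomputable def sweedlerComul :
    (sweedlerBimod i).X ⟶ (relBimod (sweedlerBimod i) (sweedlerBimod i)).X :=
  relDesc (.ofBimod (restrictRight i)) (restrictLeft i)
    ((sweedlerInl i ⊗ₘ sweedlerInr i) ≫ relπ (.ofBimod (sweedlerBimod i)) (sweedlerBimod i)) (by
      have h1 : (A.X ◁ i.hom ≫ μ) ▷ A.X ≫ (sweedlerInl i ⊗ₘ sweedlerInr i) =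
          ((sweedlerInl i ⊗ₘ i.hom) ≫ (sweedlerBimod i).actRight) ⊗ₘ sweedlerInr i := by
        rw [← tensorHom_id, tensorHom_comp_tensorHom, Category.id_comp, sweedlerInl_restrict]
      have h2 : A.X ◁ (i.hom ▷ A.X ≫ μ) ≫ (sweedlerInl i ⊗ₘ sweedlerInr i) =
          sweedlerInl i ⊗ₘ ((i.hom ⊗ₘ sweedlerInr i) ≫ (sweedlerBimod i).actLeft) := by
        rw [← id_tensorHom, tensorHom_comp_tensorHom, Category.id_comp, sweedlerInr_restrict]
      have h3 := rel_balance (.ofBimod (sweedlerBimod i)) (sweedlerBimod i)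
        (sweedlerInl i) i.hom (sweedlerInr i)
      rw [← Category.assoc, h1, ← Category.assoc (A.X ◁ _), h2]
      exact h3)

theorem sweedlerπ_comul : sweedlerπ i ≫ sweedlerComul i =
    (sweedlerInl i ⊗ₘ sweedlerInr i) ≫ relπ (.ofBimod (sweedlerBimod i)) (sweedlerBimod i) :=
  relπ_desc _ _ _ _

theorem sweedlerCounit_left :
    (sweedlerBimod i).actLeft ≫ sweedlerCounit i = A.X ◁ sweedlerCounit i ≫ μ := by
  rw [← cancel_epi (A.X ◁ sweedlerπ i), ← Category.assoc, sweedlerπ_actLeft,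
    ← MonoidalCategory.whiskerLeft_comp_assoc]
  simp [sweedlerπ_counit]

theorem sweedlerCounit_right :
    (sweedlerBimod i).actRight ≫ sweedlerCounit i = sweedlerCounit i ▷ A.X ≫ μ := by
  rw [← cancel_epi (sweedlerπ i ▷ A.X), ← Category.assoc, sweedlerπ_actRight,
    ← comp_whiskerRight_assoc]
  simp [sweedlerπ_counit]

theorem sweedlerComul_left :
    (sweedlerBimod i).actLeft ≫ sweedlerComul i =
      A.X ◁ sweedlerComul i ≫ (relBimod (sweedlerBimod i) (sweedlerBimod i)).actLeft := by
  rw [← cancel_epi (A.X ◁ sweedlerπ i), ← Category.assoc, sweedlerπ_actLeft,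
    ← MonoidalCategory.whiskerLeft_comp_assoc, Category.assoc, Category.assoc, sweedlerπ_comul]
  have h := rel_actLeft (sweedlerBimod i) (sweedlerBimod i) (𝟙 A.X) (sweedlerInl i) (sweedlerInr i)
  rw [id_tensorHom, id_tensorHom, sweedlerInl_actLeft] at h
  refine Eq.trans ?_ h.symm
  rw [← tensorHom_id, tensorHom_comp_tensorHom_assoc, Category.id_comp]

theorem sweedlerComul_right :
    (sweedlerBimod i).actRight ≫ sweedlerComul i =
      sweedlerComul i ▷ A.X ≫ (relBimod (sweedlerBimod i) (sweedlerBimod i)).actRight := by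
  rw [← cancel_epi (sweedlerπ i ▷ A.X), ← Category.assoc, sweedlerπ_actRight,
    ← comp_whiskerRight_assoc, Category.assoc, Category.assoc, sweedlerπ_comul]
  have h := rel_actRight (.ofBimod (sweedlerBimod i)) (sweedlerBimod i)
    (sweedlerInl i) (sweedlerInr i) (𝟙 A.X)
  rw [tensorHom_id, tensorHom_id, sweedlerInr_actRight] at h
  refine Eq.trans ?_ h.symm
  rw [← id_tensorHom, tensorHom_comp_tensorHom_assoc, Category.id_comp]

theorem sweedlerInl_counit : sweedlerInl i ≫ sweedlerCounit i = 𝟙 A.X := by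
  rw [sweedlerInl, Category.assoc, Category.assoc, sweedlerπ_counit, MonObj.mul_one]
  simp

theorem sweedlerInr_counit : sweedlerInr i ≫ sweedlerCounit i = 𝟙 A.X := by
  rw [sweedlerInr, Category.assoc, Category.assoc, sweedlerπ_counit, MonObj.one_mul]
  simp

theorem sweedlerInl_comul : sweedlerInl i ≫ sweedlerComul i =
    (ρ_ A.X).inv ≫ (sweedlerInl i ⊗ₘ (η ≫ sweedlerInr i)) ≫
      relπ (.ofBimod (sweedlerBimod i)) (sweedlerBimod i) := by
  rw [sweedlerInl, Category.assoc, Category.assoc, sweedlerπ_comul, ← sweedlerInl,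
    ← id_tensorHom, tensorHom_comp_tensorHom_assoc, Category.id_comp]

theorem sweedlerInr_comul : sweedlerInr i ≫ sweedlerComul i =
    (λ_ A.X).inv ≫ ((η ≫ sweedlerInl i) ⊗ₘ sweedlerInr i) ≫
      relπ (.ofBimod (sweedlerBimod i)) (sweedlerBimod i) := by
  rw [sweedlerInr, Category.assoc, Category.assoc, sweedlerπ_comul, ← sweedlerInr,
    ← tensorHom_id, tensorHom_comp_tensorHom_assoc, Category.id_comp]

/-- The counit of `A ⊗_B A` as a morphism of bimodules. -/
noncomputable abbrev sweedlerCounitHom : sweedlerBimod i ⟶ Bimod.regular A :=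
  Bimod.Hom.mk (M := sweedlerBimod i) (N := Bimod.regular A) (sweedlerCounit i)
    (sweedlerCounit_left i) (sweedlerCounit_right i)

/-- The comultiplication of `A ⊗_B A` as a morphism of bimodules. -/
noncomputable abbrev sweedlerComulHom :
    sweedlerBimod i ⟶ relBimod (sweedlerBimod i) (sweedlerBimod i) :=
  Bimod.Hom.mk (M := sweedlerBimod i) (N := relBimod (sweedlerBimod i) (sweedlerBimod i))
    (sweedlerComul i) (sweedlerComul_left i) (sweedlerComul_right i)

theorem sweedlerπ_comul_map {M : RightMod A} {P : Bimod A A}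
    (f : RightMod.ofBimod (sweedlerBimod i) ⟶ M) (g : sweedlerBimod i ⟶ P) :
    sweedlerπ i ≫ sweedlerComul i ≫ relMap f g =
      ((sweedlerInl i ≫ f.hom) ⊗ₘ (sweedlerInr i ≫ g.hom)) ≫ relπ M P := by
  rw [← Category.assoc, sweedlerπ_comul, Category.assoc, relπ_map, tensorHom_comp_tensorHom_assoc]

/-- The Sweedler coring `A ⊗_B A` of a morphism of algebras `i : B ⟶ A`. -/
noncomputable def sweedlerCoring : Coring A where
  M := sweedlerBimod i
  counit := sweedlerCounitHom i
  comul := sweedlerComulHom i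
  counit_comul := by
    apply rel_ext
    have h := sweedlerπ_comul_map i (RightMod.ofBimodMap (sweedlerCounitHom i)) (𝟙 (sweedlerBimod i))
    have h2 : (sweedlerInl i ≫ sweedlerCounit i ⊗ₘ
        sweedlerInr i ≫ Bimod.Hom.hom (𝟙 (sweedlerBimod i))) = A.X ◁ sweedlerInr i := by
      rw [sweedlerInl_counit, Bimod.id_hom', Category.comp_id, id_tensorHom]
    have h3 := congr($h ≫ relLeftUnit (sweedlerBimod i))
    rw [Category.assoc, Category.assoc, Category.assoc, relπ_leftUnit] at h3
    refine h3.trans ?_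
    refine Eq.trans ?_ (Category.comp_id _).symm
    exact congr($h2 ≫ (sweedlerBimod i).actLeft).trans (sweedlerInr_actLeft i)
  comul_counit := by
    apply rel_ext
    have h := sweedlerπ_comul_map i (𝟙 (RightMod.ofBimod (sweedlerBimod i))) (sweedlerCounitHom i)
    have h2 : (sweedlerInl i ≫ RightMod.Hom.hom (𝟙 (RightMod.ofBimod (sweedlerBimod i))) ⊗ₘ
        sweedlerInr i ≫ sweedlerCounit i) = sweedlerInl i ▷ A.X := by
      rw [sweedlerInr_counit, RightMod.id_hom, Category.comp_id, tensorHom_id]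
    have h3 := congr($h ≫ relRightUnit (.ofBimod (sweedlerBimod i)))
    rw [Category.assoc, Category.assoc, Category.assoc, relπ_rightUnit] at h3
    refine h3.trans ?_
    refine Eq.trans ?_ (Category.comp_id _).symm
    exact congr($h2 ≫ (sweedlerBimod i).actRight).trans (sweedlerInl_actRight i)
  comul_assoc := by
    apply rel_ext
    have h1 := sweedlerπ_comul_map i (RightMod.ofBimodMap (sweedlerComulHom i))
      (𝟙 (sweedlerBimod i))
    have h2 := sweedlerπ_comul_map i (𝟙 (RightMod.ofBimod (sweedlerBimod i))) (sweedlerComulHom i)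
    refine Eq.trans ?_ h2.symm
    have h3 := congr($h1 ≫ relAssoc (.ofBimod (sweedlerBimod i)) (sweedlerBimod i)
      (sweedlerBimod i))
    rw [Category.assoc, Category.assoc] at h3
    refine h3.trans ?_
    have h4 := rel_assoc (.ofBimod (sweedlerBimod i)) (sweedlerBimod i) (sweedlerBimod i)
      (sweedlerInl i) (η ≫ sweedlerInr i) (sweedlerInr i)
    rw [Bimod.id_hom', Category.comp_id, RightMod.id_hom, Category.comp_id]
    dsimp only [RightMod.ofBimodMap]
    rw [sweedlerInl_comul, sweedlerInr_comul, sweedler_one_inl,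
      rightUnitor_inv_comp_tensor, tensor_leftUnitor_inv_comp, Category.assoc, Category.assoc]
    refine congr((ρ_ A.X).inv ▷ A.X ≫ $h4).trans ?_
    rw [← Category.assoc, triangle_assoc_comp_right_inv, Category.assoc]

end Sweedler

/-- An entwining structure `(C, A, λ)`: the four identities say that `- ⊗ λ` is a mixed
distributive law from the monad `- ⊗ A` to the comonad `- ⊗ C`. -/
structure EntwiningStructure (C : Comon V) (A : Mon V) where
  /-- The entwining map. -/
  ψ : C.X ⊗ A.X ⟶ A.X ⊗ C.X
  unit_ψ : C.X ◁ η[A.X] ≫ ψ = (ρ_ C.X).hom ≫ (λ_ C.X).inv ≫ η[A.X] ▷ C.X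
  ψ_counit : ψ ≫ A.X ◁ ε[C.X] = ε[C.X] ▷ A.X ≫ (λ_ A.X).hom ≫ (ρ_ A.X).inv
  ψ_comul :
    ψ ≫ A.X ◁ Δ[C.X] =
      Δ[C.X] ▷ A.X ≫ (α_ C.X C.X A.X).hom ≫ C.X ◁ ψ ≫ (α_ C.X A.X C.X).inv ≫
        ψ ▷ C.X ≫ (α_ A.X C.X C.X).hom
  mul_ψ :
    C.X ◁ μ[A.X] ≫ ψ =
      (α_ C.X A.X A.X).inv ≫ ψ ▷ A.X ≫ (α_ A.X C.X A.X).hom ≫ A.X ◁ ψ ≫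
        (α_ A.X A.X C.X).inv ≫ μ[A.X] ▷ C.X

/-- A group-like element of a coalgebra. -/
structure GroupLike (C : Comon V) where
  /-- The underlying morphism. -/
  g : 𝟙_ V ⟶ C.X
  g_counit : g ≫ ε[C.X] = 𝟙 (𝟙_ V)
  g_comul : g ≫ Δ[C.X] = (λ_ (𝟙_ V)).inv ≫ (g ⊗ₘ g)

variable {C : Comon V} {A : Mon V} (E : EntwiningStructure C A)

/-- An entwined module: a right `A`-module and right `C`-comodule `(M, ξ, ν)` with
`(ξ ⊗ C) (M ⊗ λ) (ν ⊗ A) = ν ξ`. -/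
structure EntwinedModule extends RightMod A where
  /-- The right coaction. -/
  coact : X ⟶ X ⊗ C.X
  coact_counit : coact ≫ X ◁ ε[C.X] = (ρ_ X).inv
  coact_comul : coact ≫ X ◁ Δ[C.X] = coact ≫ coact ▷ C.X ≫ (α_ X C.X C.X).hom
  act_coact :
    coact ▷ A.X ≫ (α_ X C.X A.X).hom ≫ X ◁ E.ψ ≫ (α_ X A.X C.X).inv ≫ act ▷ C.X =
      act ≫ coact

namespace EntwinedModule

variable {E}

/-- A morphism of entwined modules is a morphism which is both `A`-linear and `C`-colinear. -/
@[ext]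
structure Hom (M N : EntwinedModule E) where
  /-- The underlying morphism. -/
  hom : M.X ⟶ N.X
  act_hom : M.act ≫ hom = hom ▷ A.X ≫ N.act
  coact_hom : M.coact ≫ hom ▷ C.X = hom ≫ N.coact

instance : Category (EntwinedModule E) where
  Hom M N := Hom M N
  id M := { hom := 𝟙 M.X, act_hom := by simp, coact_hom := by simp }
  comp f g :=
    { hom := f.hom ≫ g.hom
      act_hom := by
        rw [← Category.assoc, f.act_hom, Category.assoc, g.act_hom, comp_whiskerRight,
          Category.assoc]
      coact_hom := by
        rw [comp_whiskerRight, ← Category.assoc, f.coact_hom, Category.assoc, g.coact_hom,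
          Category.assoc] }
  id_comp f := by ext; simp
  comp_id f := by ext; simp
  assoc f g h := by ext; simp

end EntwinedModule

theorem one_mul_whisker (A : Mon V) (C : V) :
    A.X ◁ (λ_ C).inv ≫ A.X ◁ η[A.X] ▷ C ≫ (α_ A.X A.X C).inv ≫ μ[A.X] ▷ C = 𝟙 (A.X ⊗ C) := by
  have h := congr($(MonObj.mul_one A.X) ▷ C)
  rw [comp_whiskerRight] at h
  rw [associator_inv_naturality_middle_assoc, h]
  simp

/-- The bimodule `A ⊗ C` of an entwining structure: the left action is `m_A ⊗ C` and the right
action is `(m_A ⊗ C) (A ⊗ λ)`. -/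
@[simps]
abbrev entwiningBimod : Bimod A A where
  X := A.X ⊗ C.X
  actLeft := (α_ A.X A.X C.X).inv ≫ μ ▷ C.X
  one_actLeft := by
    rw [associator_inv_naturality_left_assoc, ← comp_whiskerRight, MonObj.one_mul]
    simp
  left_assoc := by
    have h := mul_assoc_whisker A C.X (𝟙 _)
    simp only [Category.comp_id] at h
    simp [h]
  actRight := (α_ A.X C.X A.X).hom ≫ A.X ◁ E.ψ ≫ (α_ A.X A.X C.X).inv ≫ μ ▷ C.X
  actRight_one := by
    rw [associator_naturality_right_assoc, ← MonoidalCategory.whiskerLeft_comp_assoc, E.unit_ψ]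
    simp [one_mul_whisker]
  right_assoc := by
    have h := mul_assoc_whisker A C.X (𝟙 _)
    simp only [Category.comp_id] at h
    rw [associator_naturality_right_assoc, ← MonoidalCategory.whiskerLeft_comp_assoc, E.mul_ψ]
    simp [h, exchange_inv₂]
  middle_assoc := by
    have h := mul_assoc_whisker A C.X (𝟙 _)
    simp only [Category.comp_id] at h
    simp [h, exchange_inv₂]

variable (g : GroupLike C)

/-- The coaction `g_A : A ⟶ C ⊗ A ⟶ A ⊗ C` defined by the group-like element. -/
def coactA : A.X ⟶ A.X ⊗ C.X :=
  (λ_ A.X).inv ≫ g.g ▷ A.X ≫ E.ψ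

theorem coactA_counit : coactA E g ≫ A.X ◁ ε[C.X] = (ρ_ A.X).inv := by
  rw [coactA, Category.assoc, Category.assoc, E.ψ_counit, ← comp_whiskerRight_assoc, g.g_counit]
  simp

theorem coactA_comul :
    coactA E g ≫ A.X ◁ Δ[C.X] = coactA E g ≫ coactA E g ▷ C.X ≫ (α_ A.X C.X C.X).hom := by
  simp only [coactA, Category.assoc, E.ψ_comul]
  rw [← comp_whiskerRight_assoc, g.g_comul]
  have h1 : g.g ▷ A.X ≫ C.X ◁ (λ_ A.X).inv ≫ C.X ◁ g.g ▷ A.X ≫ C.X ◁ E.ψ =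
      (λ_ _).hom ≫ ((λ_ A.X).inv ≫ g.g ▷ A.X ≫ E.ψ) ≫ (λ_ _).inv ≫ g.g ▷ (A.X ⊗ C.X) := by
    rw [← leftUnitor_naturality_assoc, Iso.hom_inv_id_assoc, whisker_exchange]
    simp
  have h2 := congr((λ_ A.X).inv ≫ $h1 ≫ (α_ C.X A.X C.X).inv ≫ E.ψ ▷ C.X ≫ (α_ A.X C.X C.X).hom)
  simp only [Category.assoc] at h2
  simp [MonoidalCategory.tensorHom_def]
  simp at h2
  exact h2

theorem coactA_mul :
    coactA E g ▷ A.X ≫ (α_ A.X C.X A.X).hom ≫ A.X ◁ E.ψ ≫ (α_ A.X A.X C.X).inv ≫ μ ▷ C.X =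
      μ ≫ coactA E g := by
  simp only [coactA]
  rw [leftUnitor_inv_naturality_assoc, whisker_exchange_assoc, E.mul_ψ]
  simp

theorem one_coactA : η ≫ coactA E g = η ≫ (ρ_ A.X).inv ≫ A.X ◁ g.g := by
  simp only [coactA]
  rw [leftUnitor_inv_naturality_assoc, whisker_exchange_assoc, E.unit_ψ,
    rightUnitor_inv_naturality_assoc, ← whisker_exchange]
  simp [unitors_equal, unitors_inv_equal]

/-- `A` as an entwined module. -/
@[simps]
def regularEntwined : EntwinedModule E where
  X := A.X
  act := μ
  act_one := by simp
  act_mul := by simp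
  coact := coactA E g
  coact_counit := coactA_counit E g
  coact_comul := coactA_comul E g
  act_coact := coactA_mul E g

section Coinvariants

variable [HasEqualizers V]

/-- The object of coinvariants `A^C`, the equalizer of `g_A` and `A ⊗ g`. -/
noncomputable def coinv : V := equalizer (coactA E g) ((ρ_ A.X).inv ≫ A.X ◁ g.g)

/-- The inclusion `i_A : A^C ⟶ A`. -/
noncomputable def coinvι : coinv E g ⟶ A.X := equalizer.ι _ _

theorem coinvι_condition :
    coinvι E g ≫ coactA E g = coinvι E g ≫ (ρ_ A.X).inv ≫ A.X ◁ g.g :=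
  equalizer.condition _ _

/-- `g_A(i(b) a) = i(b) g_A(a)` -/
theorem coinv_coactA :
    coinvι E g ▷ A.X ≫ μ ≫ coactA E g =
      coinvι E g ▷ A.X ≫ A.X ◁ coactA E g ≫ (α_ A.X A.X C.X).inv ≫ μ ▷ C.X := by
  rw [← coactA_mul, ← comp_whiskerRight_assoc, coinvι_condition]
  simp [coactA]

theorem coinv_mul_condition :
    ((coinvι E g ⊗ₘ coinvι E g) ≫ μ) ≫ coactA E g =
      ((coinvι E g ⊗ₘ coinvι E g) ≫ μ) ≫ (ρ_ A.X).inv ≫ A.X ◁ g.g := by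
  rw [MonoidalCategory.tensorHom_def', Category.assoc, Category.assoc, coinv_coactA,
    whisker_exchange_assoc, ← MonoidalCategory.whiskerLeft_comp_assoc, coinvι_condition,
    Category.assoc, Category.assoc, whisker_exchange_assoc]
  have h : μ ≫ (ρ_ A.X).inv ≫ A.X ◁ g.g =
      (ρ_ (A.X ⊗ A.X)).inv ≫ (α_ A.X A.X (𝟙_ V)).hom ≫ A.X ◁ A.X ◁ g.g ≫
        (α_ A.X A.X C.X).inv ≫ μ ▷ C.X := by
    rw [rightUnitor_inv_naturality_assoc, ← whisker_exchange]
    simp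
  simp [h]

instance : Mono (coinvι E g) := inferInstanceAs (Mono (equalizer.ι _ _))

/-- The unit of `A^C`. -/
noncomputable def coinvOne : 𝟙_ V ⟶ coinv E g := equalizer.lift η (one_coactA E g)

/-- The multiplication of `A^C`. -/
noncomputable def coinvMul : coinv E g ⊗ coinv E g ⟶ coinv E g :=
  equalizer.lift ((coinvι E g ⊗ₘ coinvι E g) ≫ μ) (coinv_mul_condition E g)

theorem coinvOne_ι : coinvOne E g ≫ coinvι E g = η := equalizer.lift_ι _ _

theorem coinvMul_ι : coinvMul E g ≫ coinvι E g = (coinvι E g ⊗ₘ coinvι E g) ≫ μ :=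
  equalizer.lift_ι _ _

/-- The algebra of coinvariants `A^C`: the multiplication and unit are the unique ones making
`i_A` a morphism of algebras. -/
noncomputable instance : MonObj (coinv E g) where
  one := coinvOne E g
  mul := coinvMul E g
  one_mul := by
    rw [← cancel_mono (coinvι E g), Category.assoc, coinvMul_ι, MonoidalCategory.tensorHom_def,
      Category.assoc, ← comp_whiskerRight_assoc, coinvOne_ι, ← whisker_exchange_assoc,
      MonObj.one_mul, leftUnitor_naturality]
  mul_one := by
    rw [← cancel_mono (coinvι E g), Category.assoc, coinvMul_ι, MonoidalCategory.tensorHom_def',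
      Category.assoc, ← MonoidalCategory.whiskerLeft_comp_assoc, coinvOne_ι,
      whisker_exchange_assoc, MonObj.mul_one, rightUnitor_naturality]
  mul_assoc := by
    rw [← cancel_mono (coinvι E g)]
    simp only [Category.assoc, coinvMul_ι]
    rw [← tensorHom_id, tensorHom_comp_tensorHom_assoc, coinvMul_ι, ← id_tensorHom,
      tensorHom_comp_tensorHom_assoc, coinvMul_ι, Category.id_comp]
    have h1 : (((coinvι E g ⊗ₘ coinvι E g) ≫ μ[A.X]) ⊗ₘ coinvι E g) =
        ((coinvι E g ⊗ₘ coinvι E g) ⊗ₘ coinvι E g) ≫ μ[A.X] ▷ A.X := by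
      rw [← tensorHom_id, tensorHom_comp_tensorHom, Category.comp_id]
    have h2 : (coinvι E g ⊗ₘ ((coinvι E g ⊗ₘ coinvι E g) ≫ μ[A.X])) =
        (coinvι E g ⊗ₘ (coinvι E g ⊗ₘ coinvι E g)) ≫ A.X ◁ μ[A.X] := by
      rw [← id_tensorHom, tensorHom_comp_tensorHom, Category.comp_id]
    rw [h1, h2, Category.assoc, Category.assoc, MonObj.mul_assoc, associator_naturality_assoc]

/-- The algebra `A^C`. -/
noncomputable abbrev coinvAlg : Mon V := ⟨coinv E g⟩

/-- The inclusion `i_A : A^C ⟶ A` as a morphism of algebras. -/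
noncomputable abbrev coinvIncl : coinvAlg E g ⟶ A where
  hom := coinvι E g
  isMonHom_hom :=
    { one_hom := coinvOne_ι E g
      mul_hom := coinvMul_ι E g }

end Coinvariants
/-- The morphism `C ⟶ A ⊗ C`, `c ↦ 1 ⊗ c`. -/
def entInr (C : Comon V) (A : Mon V) : C.X ⟶ A.X ⊗ C.X := (λ_ C.X).inv ≫ η ▷ C.X

theorem entInr_actLeft : A.X ◁ entInr C A ≫ (entwiningBimod E).actLeft = 𝟙 (A.X ⊗ C.X) := by
  have h := one_mul_whisker A C.X
  simp only [entInr, MonoidalCategory.whiskerLeft_comp, Category.assoc]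
  exact h

theorem entInr_actRight : entInr C A ▷ A.X ≫ (entwiningBimod E).actRight = E.ψ := by
  have h : η ▷ (A.X ⊗ C.X) ≫ (α_ A.X A.X C.X).inv ≫ μ ▷ C.X = (λ_ (A.X ⊗ C.X)).hom := by
    rw [associator_inv_naturality_left_assoc, ← comp_whiskerRight, MonObj.one_mul]
    simp
  simp only [entInr, comp_whiskerRight, Category.assoc]
  rw [associator_naturality_left_assoc, ← whisker_exchange_assoc, h, leftUnitor_naturality]
  simp

/-- The counit `A ⊗ ε` of `A ⊗ C`. -/
def entCounit (C : Comon V) (A : Mon V) : A.X ⊗ C.X ⟶ A.X := A.X ◁ ε[C.X] ≫ (ρ_ A.X).hom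

theorem entCounit_left :
    (entwiningBimod E).actLeft ≫ entCounit C A = A.X ◁ entCounit C A ≫ μ := by
  simp only [entCounit, Category.assoc]
  rw [← whisker_exchange_assoc]
  simp

theorem entCounit_right :
    (entwiningBimod E).actRight ≫ entCounit C A = entCounit C A ▷ A.X ≫ μ := by
  simp only [entCounit, Category.assoc]
  rw [← whisker_exchange_assoc, tensor_whiskerLeft, Category.assoc, Category.assoc,
    Iso.inv_hom_id_assoc, ← MonoidalCategory.whiskerLeft_comp_assoc, E.ψ_counit]
  simp

theorem entInr_counit : entInr C A ≫ entCounit C A = ε ≫ η := by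
  rw [entInr, entCounit, Category.assoc, ← whisker_exchange_assoc]
  simp [unitors_inv_equal]

section EntwiningCoring

variable [HasCoequalizers V]

/-- The canonical isomorphism `A ⊗ C ⊗ C ⟶ (A ⊗ C) ⊗_A (A ⊗ C)`,
`a ⊗ c ⊗ c' ↦ (a ⊗ c) ⊗ (1 ⊗ c')`. -/
noncomputable def entCanon :
    (A.X ⊗ C.X) ⊗ C.X ⟶ relTensor (.ofBimod (entwiningBimod E)) (entwiningBimod E) :=
  (A.X ⊗ C.X) ◁ entInr C A ≫ relπ (.ofBimod (entwiningBimod E)) (entwiningBimod E)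

/-- The comultiplication of `A ⊗ C`: the composite of `A ⊗ δ` with the canonical isomorphism
`A ⊗ C ⊗ C ≅ (A ⊗ C) ⊗_A (A ⊗ C)`. -/
noncomputable def entComul :
    A.X ⊗ C.X ⟶ relTensor (.ofBimod (entwiningBimod E)) (entwiningBimod E) :=
  A.X ◁ Δ[C.X] ≫ (α_ A.X C.X C.X).inv ≫ entCanon E

theorem entCanon_balance :
    relπ (.ofBimod (entwiningBimod E)) (entwiningBimod E) =
      (α_ (A.X ⊗ C.X) A.X C.X).inv ≫ (entwiningBimod E).actRight ▷ C.X ≫ entCanon E := by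
  have h := rel_balance (.ofBimod (entwiningBimod E)) (entwiningBimod E) (𝟙 (A.X ⊗ C.X)) (𝟙 A.X)
    (entInr C A)
  rw [id_tensorHom_id, Category.id_comp, id_tensorHom, id_tensorHom, entInr_actLeft,
    MonoidalCategory.whiskerLeft_id, Category.id_comp] at h
  rw [← cancel_epi (α_ (A.X ⊗ C.X) A.X C.X).hom, Iso.hom_inv_id_assoc]
  refine h.symm.trans ?_
  rw [MonoidalCategory.tensorHom_def, Category.assoc]
  rfl

theorem entInr_comul : entInr C A ≫ entComul E =
    Δ ≫ (entInr C A ⊗ₘ entInr C A) ≫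
      relπ (.ofBimod (entwiningBimod E)) (entwiningBimod E) := by
  rw [MonoidalCategory.tensorHom_def, Category.assoc]
  change _ = Δ ≫ entInr C A ▷ C.X ≫ entCanon E
  rw [entInr, entComul, Category.assoc, ← whisker_exchange_assoc]
  simp

theorem entComul_map {M : RightMod A} {P : Bimod A A}
    (f : RightMod.ofBimod (entwiningBimod E) ⟶ M) (g : entwiningBimod E ⟶ P) :
    entComul E ≫ relMap f g =
      A.X ◁ Δ[C.X] ≫ (α_ A.X C.X C.X).inv ≫ (f.hom ⊗ₘ (entInr C A ≫ g.hom)) ≫ relπ M P := by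
  simp only [entComul, entCanon, Category.assoc]
  rw [relπ_map, ← id_tensorHom (A.X ⊗ C.X), tensorHom_comp_tensorHom_assoc]
  congr 4
  exact Category.id_comp _

variable [∀ X : V, PreservesColimitsOfShape WalkingParallelPair (tensorLeft X)]
variable [∀ X : V, PreservesColimitsOfShape WalkingParallelPair (tensorRight X)]

theorem entComul_left :
    (entwiningBimod E).actLeft ≫ entComul E =
      A.X ◁ entComul E ≫ (relBimod (entwiningBimod E) (entwiningBimod E)).actLeft := by
  have h := rel_actLeft (entwiningBimod E) (entwiningBimod E) (𝟙 A.X) (𝟙 (A.X ⊗ C.X)) (entInr C A)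
  rw [id_tensorHom, id_tensorHom, id_tensorHom_id, Category.id_comp, MonoidalCategory.tensorHom_def,
    Category.assoc] at h
  have h' : A.X ◁ entCanon E ≫ (relBimod (entwiningBimod E) (entwiningBimod E)).actLeft =
    (α_ A.X (A.X ⊗ C.X) C.X).inv ≫ (entwiningBimod E).actLeft ▷ C.X ≫ entCanon E := h
  simp only [entComul, MonoidalCategory.whiskerLeft_comp, Category.assoc]
  rw [h']
  rw [← whisker_exchange_assoc]
  simp

theorem entComul_right :
    (entwiningBimod E).actRight ≫ entComul E =
      entComul E ▷ A.X ≫ (relBimod (entwiningBimod E) (entwiningBimod E)).actRight := by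
  have h := rel_actRight (.ofBimod (entwiningBimod E)) (entwiningBimod E) (𝟙 (A.X ⊗ C.X))
    (entInr C A) (𝟙 A.X)
  rw [tensorHom_id, tensorHom_id, entInr_actRight, id_tensorHom, id_tensorHom] at h
  have h' : entCanon E ▷ A.X ≫ (relBimod (entwiningBimod E) (entwiningBimod E)).actRight =
    (α_ (A.X ⊗ C.X) C.X A.X).hom ≫ (A.X ⊗ C.X) ◁ E.ψ ≫
      (α_ (A.X ⊗ C.X) A.X C.X).inv ≫ (entwiningBimod E).actRight ▷ C.X ≫ entCanon E := by
    rw [← entCanon_balance]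
    exact h
  simp only [entComul, comp_whiskerRight, Category.assoc]
  rw [h']
  simp
  have h1 := congr(A.X ◁ $(E.ψ_comul) ≫ (α_ A.X A.X (C.X ⊗ C.X)).inv ≫ μ ▷ (C.X ⊗ C.X) ≫
    (α_ A.X C.X C.X).inv ≫ entCanon E)
  rw [← whisker_exchange_assoc]
  simp at h1 ⊢
  rw [h1]

/-- The counit of `A ⊗ C` as a morphism of bimodules. -/
abbrev entCounitHom : entwiningBimod E ⟶ Bimod.regular A :=
  Bimod.Hom.mk (M := entwiningBimod E) (N := Bimod.regular A) (entCounit C A)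
    (entCounit_left E) (entCounit_right E)

/-- The comultiplication of `A ⊗ C` as a morphism of bimodules. -/
noncomputable abbrev entComulHom :
    entwiningBimod E ⟶ relBimod (entwiningBimod E) (entwiningBimod E) :=
  Bimod.Hom.mk (M := entwiningBimod E) (N := relBimod (entwiningBimod E) (entwiningBimod E))
    (entComul E) (entComul_left E) (entComul_right E)

/-- The coring `(A ⊗ C)_λ` of an entwining structure. -/
noncomputable def entwiningCoring : Coring A where
  M := entwiningBimod E
  counit := entCounitHom E
  comul := entComulHom E
  counit_comul := by
    have h := entComul_map E (RightMod.ofBimodMap (entCounitHom E)) (𝟙 (entwiningBimod E))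
    have h3 := congr($h ≫ relLeftUnit (entwiningBimod E))
    simp only [Category.assoc] at h3
    rw [relπ_leftUnit] at h3
    refine h3.trans ?_
    have h4 := entInr_actLeft E
    rw [Bimod.id_hom', Category.comp_id]
    have h6 : (entCounit C A ⊗ₘ entInr C A) ≫ (entwiningBimod E).actLeft =
        entCounit C A ▷ C.X ≫ A.X ◁ entInr C A ≫ (entwiningBimod E).actLeft := by
      rw [MonoidalCategory.tensorHom_def, Category.assoc]
    refine congr(A.X ◁ Δ[C.X] ≫ (α_ A.X C.X C.X).inv ≫ $h6).trans ?_
    refine congr(A.X ◁ Δ[C.X] ≫ (α_ A.X C.X C.X).inv ≫ entCounit C A ▷ C.X ≫ $h4).trans ?_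
    have h5 := congr(A.X ◁ $(ComonObj.counit_comul C.X))
    simp only [MonoidalCategory.whiskerLeft_comp] at h5
    rw [entCounit, comp_whiskerRight, Category.assoc,
      ← associator_inv_naturality_middle_assoc, reassoc_of% h5]
    simp
  comul_counit := by
    have h := entComul_map E (𝟙 (RightMod.ofBimod (entwiningBimod E))) (entCounitHom E)
    have h3 := congr($h ≫ relRightUnit (.ofBimod (entwiningBimod E)))
    simp only [Category.assoc] at h3
    rw [relπ_rightUnit] at h3
    refine h3.trans ?_
    rw [RightMod.id_hom]
    have h6 : (𝟙 (A.X ⊗ C.X) ⊗ₘ (entInr C A ≫ entCounit C A)) ≫ (entwiningBimod E).actRight =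
        (A.X ⊗ C.X) ◁ ε ≫ (A.X ⊗ C.X) ◁ η ≫ (entwiningBimod E).actRight := by
      rw [entInr_counit, id_tensorHom, MonoidalCategory.whiskerLeft_comp, Category.assoc]
    refine congr(A.X ◁ Δ[C.X] ≫ (α_ A.X C.X C.X).inv ≫ $h6).trans ?_
    refine congr(A.X ◁ Δ[C.X] ≫ (α_ A.X C.X C.X).inv ≫ (A.X ⊗ C.X) ◁ ε ≫
      $((entwiningBimod E).actRight_one)).trans ?_
    have h5 := congr(A.X ◁ $(ComonObj.comul_counit C.X))
    simp only [MonoidalCategory.whiskerLeft_comp] at h5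
    rw [← associator_inv_naturality_right_assoc, reassoc_of% h5]
    simp
  comul_assoc := by
    have h1 := entComul_map E (RightMod.ofBimodMap (entComulHom E)) (𝟙 (entwiningBimod E))
    have h2 := entComul_map E (𝟙 (RightMod.ofBimod (entwiningBimod E))) (entComulHom E)
    refine Eq.trans ?_ h2.symm
    have h3 := congr($h1 ≫ relAssoc (.ofBimod (entwiningBimod E)) (entwiningBimod E)
      (entwiningBimod E))
    simp only [Category.assoc] at h3
    refine h3.trans ?_
    have h4 := rel_assoc (.ofBimod (entwiningBimod E)) (entwiningBimod E) (entwiningBimod E)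
      (𝟙 (A.X ⊗ C.X)) (entInr C A) (entInr C A)
    rw [Bimod.id_hom', Category.comp_id, RightMod.id_hom]
    dsimp only [RightMod.ofBimodMap]
    have h5 := congr(A.X ◁ $(ComonObj.comul_assoc C.X))
    simp only [MonoidalCategory.whiskerLeft_comp] at h5
    have h6 : (entComul E ⊗ₘ entInr C A) = (A.X ◁ Δ ≫ (α_ A.X C.X C.X).inv) ▷ C.X ≫
        ((𝟙 (A.X ⊗ C.X) ⊗ₘ entInr C A) ≫
          relπ (.ofBimod (entwiningBimod E)) (entwiningBimod E) ⊗ₘ entInr C A) := by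
      rw [← tensorHom_id, tensorHom_comp_tensorHom, Category.id_comp, id_tensorHom,
        Category.assoc]
      rfl
    have h7 : (𝟙 (A.X ⊗ C.X) ⊗ₘ entInr C A ≫ entComul E) = (A.X ⊗ C.X) ◁ Δ ≫
        (𝟙 (A.X ⊗ C.X) ⊗ₘ ((entInr C A ⊗ₘ entInr C A) ≫
          relπ (.ofBimod (entwiningBimod E)) (entwiningBimod E))) := by
      rw [← id_tensorHom, tensorHom_comp_tensorHom, Category.id_comp, entInr_comul]
    rw [h6, h7, Category.assoc, h4]
    simp only [comp_whiskerRight, Category.assoc]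
    rw [← associator_inv_naturality_right_assoc, reassoc_of% h5]
    simp

end EntwiningCoring
section Main

variable [HasEqualizers V] [HasCoequalizers V]

/-- The coaction `X ⊗_B g_A` on `X ⊗_B A`, where `B = A^C`. -/
noncomputable def inducedCoact (M : RightMod (coinvAlg E g)) :
    relTensor M (restrictLeft (coinvIncl E g)) ⟶
      relTensor M (restrictLeft (coinvIncl E g)) ⊗ C.X :=
  relDesc M (restrictLeft (coinvIncl E g))
    (M.X ◁ coactA E g ≫ (α_ M.X A.X C.X).inv ≫ relπ M (restrictLeft (coinvIncl E g)) ▷ C.X) (by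
      have h1 := congr((M.X ⊗ coinv E g) ◁ coactA E g ≫ (α_ _ _ _).inv ≫
        $(relπ_condition M (restrictLeft (coinvIncl E g))) ▷ C.X)
      have h2 := congr((α_ M.X (coinv E g) A.X).hom ≫ M.X ◁ $(coinv_coactA E g) ≫
        (α_ M.X A.X C.X).inv ≫ relπ M (restrictLeft (coinvIncl E g)) ▷ C.X)
      rw [← whisker_exchange_assoc]
      simp at h1 h2 ⊢
      rw [h1, h2]
      have h3 := congr(M.X ◁ $(whisker_exchange (coinvι E g) (coactA E g)) ≫
        M.X ◁ (α_ A.X A.X C.X).inv ≫ M.X ◁ μ ▷ C.X ≫ (α_ M.X A.X C.X).inv ≫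
          relπ M (restrictLeft (coinvIncl E g)) ▷ C.X)
      simp at h3
      exact h3)

theorem relπ_inducedCoact (M : RightMod (coinvAlg E g)) :
    relπ M (restrictLeft (coinvIncl E g)) ≫ inducedCoact E g M =
      M.X ◁ coactA E g ≫ (α_ M.X A.X C.X).inv ≫ relπ M (restrictLeft (coinvIncl E g)) ▷ C.X :=
  relπ_desc _ _ _ _

theorem inducedCoact_counit (M : RightMod (coinvAlg E g)) :
    inducedCoact E g M ≫ relTensor M (restrictLeft (coinvIncl E g)) ◁ ε[C.X] = (ρ_ _).inv := by
  apply rel_ext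
  have h := congr(M.X ◁ $(coactA_counit E g))
  simp only [MonoidalCategory.whiskerLeft_comp] at h
  rw [← Category.assoc, relπ_inducedCoact, Category.assoc, Category.assoc, ← whisker_exchange,
    ← associator_inv_naturality_right_assoc, reassoc_of% h, rightUnitor_inv_naturality]
  simp

theorem inducedCoact_comul (M : RightMod (coinvAlg E g)) :
    inducedCoact E g M ≫ relTensor M (restrictLeft (coinvIncl E g)) ◁ Δ[C.X] =
      inducedCoact E g M ≫ inducedCoact E g M ▷ C.X ≫ (α_ _ C.X C.X).hom := by
  apply rel_ext
  have h := congr(M.X ◁ $(coactA_comul E g))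
  simp only [MonoidalCategory.whiskerLeft_comp] at h
  rw [← Category.assoc, relπ_inducedCoact, Category.assoc, Category.assoc, ← whisker_exchange,
    ← associator_inv_naturality_right_assoc, reassoc_of% h, ← Category.assoc (relπ _ _),
    relπ_inducedCoact, Category.assoc, Category.assoc, ← comp_whiskerRight_assoc,
    relπ_inducedCoact]
  simp

theorem inducedCoact_map {M N : RightMod (coinvAlg E g)} (f : M ⟶ N) :
    inducedCoact E g M ≫ relMap f (𝟙 (restrictLeft (coinvIncl E g))) ▷ C.X =
      relMap f (𝟙 (restrictLeft (coinvIncl E g))) ≫ inducedCoact E g N := by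
  apply rel_ext
  rw [← Category.assoc, relπ_inducedCoact, Category.assoc, Category.assoc, ← comp_whiskerRight,
    relπ_map, relπ_map_assoc, Bimod.id_hom', tensorHom_id, relπ_inducedCoact]
  simp only [comp_whiskerRight]
  rw [← whisker_exchange_assoc]
  simp

variable [∀ X : V, PreservesColimitsOfShape WalkingParallelPair (tensorRight X)]

theorem inducedCoact_act (M : RightMod (coinvAlg E g)) :
    inducedCoact E g M ▷ A.X ≫ (α_ (relTensor M (restrictLeft (coinvIncl E g))) C.X A.X).hom ≫
        relTensor M (restrictLeft (coinvIncl E g)) ◁ E.ψ ≫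
          (α_ (relTensor M (restrictLeft (coinvIncl E g))) A.X C.X).inv ≫
            relActRight M (restrictLeft (coinvIncl E g)) ▷ C.X =
      relActRight M (restrictLeft (coinvIncl E g)) ≫ inducedCoact E g M := by
  have h := congr(M.X ◁ $(coactA_mul E g))
  simp only [MonoidalCategory.whiskerLeft_comp] at h
  rw [← cancel_epi (relπ M (restrictLeft (coinvIncl E g)) ▷ A.X), ← comp_whiskerRight_assoc,
    relπ_inducedCoact, relπ_actRight_assoc, relπ_inducedCoact]
  have h5 : relπ M (restrictLeft (coinvIncl E g)) ▷ C.X ▷ A.X ≫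
      (α_ (relTensor M (restrictLeft (coinvIncl E g))) C.X A.X).hom ≫
        relTensor M (restrictLeft (coinvIncl E g)) ◁ E.ψ ≫
          (α_ (relTensor M (restrictLeft (coinvIncl E g))) A.X C.X).inv ≫
            relActRight M (restrictLeft (coinvIncl E g)) ▷ C.X =
      (α_ (M.X ⊗ A.X) C.X A.X).hom ≫ (M.X ⊗ A.X) ◁ E.ψ ≫ (α_ (M.X ⊗ A.X) A.X C.X).inv ≫
        ((α_ M.X A.X A.X).hom ≫ M.X ◁ μ ≫ relπ M (restrictLeft (coinvIncl E g))) ▷ C.X := by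
    have h6 := relπ_actRight M (restrictLeft (coinvIncl E g))
    rw [associator_naturality_left_assoc, ← whisker_exchange_assoc,
      associator_inv_naturality_left_assoc, ← comp_whiskerRight, h6]
  simp only [comp_whiskerRight, Category.assoc]
  rw [h5, ← reassoc_of% h]
  simp

/-- The functor `F̄ : V_{A^C} ⥤ V^C_A(λ)`, sending `X` to `X ⊗_{A^C} A` with action
`X ⊗_{A^C} m_A` and coaction `X ⊗_{A^C} g_A`. -/
noncomputable def inducedFunctor : RightMod (coinvAlg E g) ⥤ EntwinedModule E where
  obj M :=
    { toRightMod := relMod M (restrictLeft (coinvIncl E g))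
      coact := inducedCoact E g M
      coact_counit := inducedCoact_counit E g M
      coact_comul := inducedCoact_comul E g M
      act_coact := inducedCoact_act E g M }
  map f :=
    { hom := relMap f (𝟙 (restrictLeft (coinvIncl E g)))
      act_hom := relMap_actRight f (𝟙 (restrictLeft (coinvIncl E g)))
      coact_hom := inducedCoact_map E g f }
  map_id M := EntwinedModule.Hom.ext (relMap_id M (restrictLeft (coinvIncl E g)))
  map_comp f h := EntwinedModule.Hom.ext (by
    have h := relMap_comp f h (𝟙 (restrictLeft (coinvIncl E g)))
      (𝟙 (restrictLeft (coinvIncl E g)))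
    rwa [Category.comp_id] at h)

variable [∀ X : V, PreservesColimitsOfShape WalkingParallelPair (tensorLeft X)]

/-- The underlying morphism of the canonical morphism `can : A ⊗_{A^C} A ⟶ A ⊗ C`, induced by
`(m_A ⊗ C) (A ⊗ g_A)`. -/
noncomputable def canMor :
    (sweedlerBimod (coinvIncl E g)).X ⟶ A.X ⊗ C.X :=
  relDesc (.ofBimod (restrictRight (coinvIncl E g))) (restrictLeft (coinvIncl E g))
    (A.X ◁ coactA E g ≫ (α_ A.X A.X C.X).inv ≫ μ ▷ C.X) (by
      have h2 := congr((α_ A.X (coinv E g) A.X).hom ≫ A.X ◁ $(coinv_coactA E g) ≫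
        (α_ A.X A.X C.X).inv ≫ μ ▷ C.X)
      have h := mul_assoc_whisker A C.X (𝟙 _)
      simp only [Category.comp_id] at h
      rw [← whisker_exchange_assoc]
      simp [h] at h2 ⊢
      have h3 := congr(A.X ◁ $(whisker_exchange (coinvι E g) (coactA E g)) ≫
        A.X ◁ (α_ A.X A.X C.X).inv ≫ A.X ◁ μ ▷ C.X ≫ (α_ A.X A.X C.X).inv ≫ μ ▷ C.X)
      simp [h] at h3
      rw [h2, h3])

theorem sweedlerπ_can : sweedlerπ (coinvIncl E g) ≫ canMor E g =
    A.X ◁ coactA E g ≫ (α_ A.X A.X C.X).inv ≫ μ ▷ C.X :=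
  relπ_desc _ _ _ _

theorem sweedlerInl_can : sweedlerInl (coinvIncl E g) ≫ canMor E g = (ρ_ A.X).inv ≫ A.X ◁ g.g := by
  have h := congr(A.X ◁ $(one_coactA E g))
  simp only [MonoidalCategory.whiskerLeft_comp] at h
  rw [sweedlerInl, Category.assoc, Category.assoc, sweedlerπ_can, reassoc_of% h]
  have h2 : A.X ◁ (ρ_ A.X).inv ≫ (α_ A.X A.X (𝟙_ V)).inv = (ρ_ (A.X ⊗ A.X)).inv := by simp
  rw [associator_inv_naturality_right_assoc, reassoc_of% h2, whisker_exchange,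
    ← rightUnitor_inv_naturality_assoc, MonObj.mul_one_assoc, Iso.inv_hom_id_assoc]

theorem sweedlerInr_can : sweedlerInr (coinvIncl E g) ≫ canMor E g = coactA E g := by
  have h : η ▷ (A.X ⊗ C.X) ≫ (α_ A.X A.X C.X).inv ≫ μ ▷ C.X = (λ_ (A.X ⊗ C.X)).hom := by
    rw [associator_inv_naturality_left_assoc, ← comp_whiskerRight, MonObj.one_mul]
    simp
  rw [sweedlerInr, Category.assoc, Category.assoc, sweedlerπ_can, ← whisker_exchange_assoc, h]
  simp

theorem can_left : (sweedlerBimod (coinvIncl E g)).actLeft ≫ canMor E g =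
    A.X ◁ canMor E g ≫ (entwiningBimod E).actLeft := by
  have h := mul_assoc_whisker A C.X (𝟙 _)
  simp only [Category.comp_id] at h
  rw [← cancel_epi (A.X ◁ sweedlerπ (coinvIncl E g)), ← Category.assoc, sweedlerπ_actLeft,
    ← MonoidalCategory.whiskerLeft_comp_assoc, Category.assoc, Category.assoc, sweedlerπ_can,
    ← whisker_exchange_assoc]
  simp [h]

theorem can_right : (sweedlerBimod (coinvIncl E g)).actRight ≫ canMor E g =
    canMor E g ▷ A.X ≫ (entwiningBimod E).actRight := by
  have h := mul_assoc_whisker A C.X (𝟙 _)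
  have h1 := congr(A.X ◁ $(coactA_mul E g))
  simp only [MonoidalCategory.whiskerLeft_comp] at h1
  simp only [Category.comp_id] at h
  rw [← cancel_epi (sweedlerπ (coinvIncl E g) ▷ A.X), ← Category.assoc, sweedlerπ_actRight,
    ← comp_whiskerRight_assoc, Category.assoc, Category.assoc, sweedlerπ_can]
  rw [← reassoc_of% h1]
  simp [h, exchange_inv₂]

theorem can_counit : canMor E g ≫ entCounit C A = sweedlerCounit (coinvIncl E g) := by
  apply rel_ext
  have h1 := congr(A.X ◁ $(coactA_counit E g))
  simp only [MonoidalCategory.whiskerLeft_comp] at h1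
  refine Eq.trans ?_ (sweedlerπ_counit (coinvIncl E g)).symm
  have h2 := congr($(sweedlerπ_can E g) ≫ entCounit C A)
  rw [Category.assoc] at h2
  refine h2.trans ?_
  simp only [entCounit, Category.assoc]
  rw [← whisker_exchange_assoc, tensor_whiskerLeft]
  simp [reassoc_of% h1]

/-- `can` as a morphism of bimodules. -/
noncomputable abbrev canBimodHom : sweedlerBimod (coinvIncl E g) ⟶ entwiningBimod E :=
  Bimod.Hom.mk (M := sweedlerBimod (coinvIncl E g)) (N := entwiningBimod E) (canMor E g)
    (can_left E g) (can_right E g)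

theorem can_comul :
    sweedlerComul (coinvIncl E g) ≫
        relMap (RightMod.ofBimodMap (canBimodHom E g)) (canBimodHom E g) =
      canMor E g ≫ entComul E := by
  apply rel_ext
  have h1 := sweedlerπ_comul_map (coinvIncl E g) (RightMod.ofBimodMap (canBimodHom E g))
    (canBimodHom E g)
  refine h1.trans ?_
  dsimp only [RightMod.ofBimodMap]
  rw [sweedlerInl_can, sweedlerInr_can, entCanon_balance]
  have h2 := congr($(sweedlerπ_can E g) ≫ entComul E)
  rw [Category.assoc] at h2
  refine Eq.trans ?_ h2.symm
  have h3 := congr(A.X ◁ $(coactA_comul E g))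
  simp only [MonoidalCategory.whiskerLeft_comp] at h3
  simp only [entComul, Category.assoc]
  rw [← whisker_exchange_assoc, tensor_whiskerLeft]
  simp only [Category.assoc, Iso.inv_hom_id_assoc, reassoc_of% h3]
  simp [MonoidalCategory.tensorHom_def]
  have h4 := congr(A.X ◁ ((λ_ A.X).inv ≫ $((whisker_exchange g.g (coactA E g)).symm) ≫
    (α_ C.X A.X C.X).inv ≫ E.ψ ▷ C.X) ≫ (α_ A.X (A.X ⊗ C.X) C.X).inv ≫
      (α_ A.X A.X C.X).inv ▷ C.X ≫ μ ▷ C.X ▷ C.X ≫ entCanon E)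
  have h5 : coactA E g ▷ C.X = (λ_ A.X).inv ▷ C.X ≫ g.g ▷ A.X ▷ C.X ≫ E.ψ ▷ C.X := by
    simp [coactA]
  rw [h5]
  simp at h4 ⊢
  rw [h4]

/-- The canonical morphism of corings `can : A ⊗_{A^C} A ⟶ (A ⊗ C)_λ`. -/
noncomputable def can : sweedlerCoring (coinvIncl E g) ⟶ entwiningCoring E :=
  Coring.Hom.mk (D := sweedlerCoring (coinvIncl E g)) (E := entwiningCoring E) (canBimodHom E g)
    (Bimod.hom_ext _ _ (can_counit E g)) (Bimod.hom_ext _ _ (can_comul E g))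

/-- `A` is `(C, g)`-Galois if `can` is an isomorphism of `A`-corings. -/
def IsGalois : Prop := IsIso (can E g)

end Main

/-- An object `C` of a monoidal category is flat if `- ⊗ C` preserves equalizers. -/
def IsFlatObj (C : V) : Prop :=
  PreservesLimitsOfShape WalkingParallelPair (tensorRight C)

end Entwining

/-! Write B for the algebra of coinvariants of A, ν for the coaction of an entwined module and U for
the functor forgetting coactions. Everything rests on two facts about `inducedFunctor`. Followed by
U it is, by definition, the functor - ⊗_B A from B-modules to A-modules. And it has a right adjoint
(`inducedAdj`), sending M to its coinvariants, the equalizer of ν and m ↦ m ⊗ g; the counit is m ⊗ a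
↦ ma.

From an equivalence to (ii): the functor U is conservative and, since C is flat, preserves
equalizers, because equalizers of entwined modules are then computed in V. Composing with an
equivalence keeps both properties, so A is faithfully flat over B. The coinvariants of the cofree
entwined module A ⊗ C are A itself, via a ↦ a ⊗ g, and under this identification the counit at A ⊗ C
is can (`canMor_eq_counit`). Hence can is invertible.

From (ii) to an equivalence: if can is invertible, so is M ⊗_B A ⟶ M ⊗ C, m ⊗ a ↦ m g_A(a), for each
A-module M, since this map is M ⊗_A can (`galoisMap_isIso`). Flatness of A over B makes M^C ⊗_B A
the equalizer of the two maps M ⊗_B A ⇉ (M ⊗ C) ⊗_B A induced by ν and by m ↦ m ⊗ g. Read through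
the Galois isomorphisms these become ν ⊗ C and M ⊗ δ, and the equalizer of the latter pair is ν : M
⟶ M ⊗ C. The comparison between the two equalizers is the counit at M, which is therefore invertible
(`isIso_counit`). Conservativity of - ⊗_B A passes to the induced functor
(`relFunctor_reflectsIsomorphisms_iff`), and a triangle identity then makes the unit invertible
(`isEquivalence_of_isIso_counit`). -/

namespace Entwining

/-! ### Restriction of scalars, entwined modules and the cofree modules M ⊗ C. -/

section EntwinedModules

variable {V : Type u} [Category.{v} V] [MonoidalCategory V]

namespace RightMod

/-- Restriction of scalars along a morphism of algebras. -/
@[simps]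
abbrev restrict {A B : Mon V} (i : B ⟶ A) (M : RightMod A) : RightMod B where
  X := M.X
  act := M.X ◁ i.hom ≫ M.act
  act_one := by
    rw [← MonoidalCategory.whiskerLeft_comp_assoc, IsMonHom.one_hom, M.act_one]
  act_mul := by
    rw [← MonoidalCategory.whiskerLeft_comp_assoc, IsMonHom.mul_hom,
      MonoidalCategory.whiskerLeft_comp_assoc, M.act_mul, MonoidalCategory.tensorHom_def]
    simp [exchange_inv]

/-- An algebra as a right module over itself. -/
@[simps]
abbrev regular (A : Mon V) : RightMod A where
  X := A.X
  act := μ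
  act_one := by simp
  act_mul := by simp

theorem act_mul_whisker {A : Mon V} (M : RightMod A) (C : V) {W : V} (h : M.X ⊗ C ⟶ W) :
    M.X ◁ μ[A.X] ▷ C ≫ (α_ M.X A.X C).inv ≫ M.act ▷ C ≫ h =
      M.X ◁ (α_ A.X A.X C).hom ≫ (α_ M.X A.X (A.X ⊗ C)).inv ≫ (α_ (M.X ⊗ A.X) A.X C).inv ≫
        M.act ▷ A.X ▷ C ≫ M.act ▷ C ≫ h := by
  have h1 := congr((α_ M.X (A.X ⊗ A.X) C).inv ≫ $(M.act_mul) ▷ C ≫ h)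
  simp only [comp_whiskerRight, Category.assoc] at h1
  rw [← associator_inv_naturality_middle_assoc] at h1
  rw [h1]
  simp

theorem act_one_whisker {A : Mon V} (M : RightMod A) (C : V) :
    M.X ◁ (λ_ C).inv ≫ M.X ◁ η[A.X] ▷ C ≫ (α_ M.X A.X C).inv ≫ M.act ▷ C = 𝟙 (M.X ⊗ C) := by
  have h := congr($(M.act_one) ▷ C)
  rw [comp_whiskerRight] at h
  rw [associator_inv_naturality_middle_assoc, h]
  simp

/-- A module morphism whose underlying morphism is invertible is invertible. -/
theorem isIso_of_isIso_hom {A : Mon V} {M N : RightMod A} (f : M ⟶ N) [IsIso f.hom] : IsIso f :=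
  ⟨{ hom := inv f.hom
     act_hom := by
      rw [← cancel_epi (f.hom ▷ A.X), ← reassoc_of% f.act_hom, ← comp_whiskerRight_assoc]
      simp }, by ext; simp, by ext; simp⟩

instance isIso_hom {A : Mon V} {M N : RightMod A} (f : M ⟶ N) [IsIso f] : IsIso f.hom :=
  ⟨(inv f).hom, by rw [← comp_hom, IsIso.hom_inv_id, id_hom],
    by rw [← comp_hom, IsIso.inv_hom_id, id_hom]⟩

end RightMod

variable {C : Comon V} {A : Mon V} (E : EntwiningStructure C A)

namespace EntwinedModule

variable {E}

@[simp]
theorem id_hom (M : EntwinedModule E) : Hom.hom (𝟙 M) = 𝟙 M.X := rfl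

@[simp]
theorem comp_hom {M N K : EntwinedModule E} (f : M ⟶ N) (g : N ⟶ K) :
    Hom.hom (f ≫ g) = f.hom ≫ g.hom := rfl

@[ext]
theorem hom_ext {M N : EntwinedModule E} (f g : M ⟶ N) (h : f.hom = g.hom) : f = g :=
  Hom.ext h

/-- An entwined module morphism whose underlying morphism is invertible is invertible. -/
theorem isIso_of_isIso_hom {M N : EntwinedModule E} (f : M ⟶ N) [IsIso f.hom] : IsIso f :=
  ⟨{ hom := inv f.hom
     act_hom := by
      rw [← cancel_epi (f.hom ▷ A.X), ← reassoc_of% f.act_hom, ← comp_whiskerRight_assoc]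
      simp
     coact_hom := by
      rw [← cancel_epi f.hom, ← reassoc_of% f.coact_hom, ← comp_whiskerRight]
      simp }, by ext; simp, by ext; simp⟩

instance isIso_hom {M N : EntwinedModule E} (f : M ⟶ N) [IsIso f] : IsIso f.hom :=
  ⟨(inv f).hom, by rw [← comp_hom, IsIso.hom_inv_id, id_hom],
    by rw [← comp_hom, IsIso.inv_hom_id, id_hom]⟩

/-- The counit ε splits the coaction. This replaces an explicit use of the split equalizer of ν ⊗ C
and M ⊗ δ in `isIso_counit`. -/
instance coact_mono (M : EntwinedModule E) : Mono M.coact :=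
  mono_of_mono_fac M.coact_counit

/-- The morphism of right modules underlying a morphism of entwined modules. -/
@[simps]
abbrev toRightModHom {M N : EntwinedModule E} (f : M ⟶ N) : M.toRightMod ⟶ N.toRightMod where
  hom := f.hom
  act_hom := f.act_hom

variable (E) in
/-- The functor forgetting the coaction. -/
@[simps]
def forget : EntwinedModule E ⥤ RightMod A where
  obj M := M.toRightMod
  map f := toRightModHom f

/-- The inverse of a colinear map is automatically colinear, so invertibility can be tested in V. -/
instance : (forget E).ReflectsIsomorphisms where
  reflects f _ :=
    have : IsIso f.hom := RightMod.isIso_hom ((forget E).map f)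
    isIso_of_isIso_hom f

variable (E) in
/-- The entwined module `M ⊗ C` cofreely generated by a right `A`-module `M`. -/
@[simps]
abbrev cofree (M : RightMod A) : EntwinedModule E where
  X := M.X ⊗ C.X
  act := (α_ M.X C.X A.X).hom ≫ M.X ◁ E.ψ ≫ (α_ M.X A.X C.X).inv ≫ M.act ▷ C.X
  act_one := by
    rw [associator_naturality_right_assoc, ← MonoidalCategory.whiskerLeft_comp_assoc, E.unit_ψ]
    simp [M.act_one_whisker]
  act_mul := by
    have h := M.act_mul_whisker C.X (𝟙 _)
    simp only [Category.comp_id] at h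
    rw [associator_naturality_right_assoc, ← MonoidalCategory.whiskerLeft_comp_assoc, E.mul_ψ]
    simp [h, exchange_inv₂]
  coact := M.X ◁ Δ ≫ (α_ M.X C.X C.X).inv
  coact_counit := by
    rw [Category.assoc, ← associator_inv_naturality_right,
      ← MonoidalCategory.whiskerLeft_comp_assoc, comul_counit]
    simp
  coact_comul := by
    rw [Category.assoc, ← associator_inv_naturality_right,
      ← MonoidalCategory.whiskerLeft_comp_assoc, comul_assoc]
    simp
  act_coact := by
    have h := congr(M.X ◁ $(E.ψ_comul) ≫ (α_ M.X A.X (C.X ⊗ C.X)).inv ≫ M.act ▷ (C.X ⊗ C.X) ≫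
      (α_ M.X C.X C.X).inv)
    rw [Category.assoc, Category.assoc, Category.assoc, ← whisker_exchange_assoc]
    simp at h ⊢
    rw [h]

/-- The coaction of an entwined module as a morphism of right modules. -/
@[simps]
def coactHom (M : EntwinedModule E) : M.toRightMod ⟶ (cofree E M.toRightMod).toRightMod where
  hom := M.coact
  act_hom := M.act_coact.symm

end EntwinedModule

end EntwinedModules

/-! ### The maps m ⊗ a ↦ m g_A(a) and m ↦ m ⊗ g, and coinvariants of entwined modules. -/

section CoinvariantModules

variable {V : Type u} [Category.{v} V] [MonoidalCategory V]

/-- Restriction of scalars on morphisms. -/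
@[simps]
def RightMod.restrictMap {A B : Mon V} (i : B ⟶ A) {M N : RightMod A} (f : M ⟶ N) :
    M.restrict i ⟶ N.restrict i where
  hom := f.hom
  act_hom := by
    simp only [Category.assoc, f.act_hom]
    rw [← whisker_exchange_assoc]

variable {C : Comon V} {A : Mon V} (E : EntwiningStructure C A) (g : GroupLike C)

/-- The morphism `m ⊗ a ↦ m g_A(a)`. -/
def actCoact (M : RightMod A) : M.X ⊗ A.X ⟶ M.X ⊗ C.X :=
  M.X ◁ coactA E g ≫ (α_ M.X A.X C.X).inv ≫ M.act ▷ C.X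

/-- The morphism `m ↦ m ⊗ g`. -/
def tensorGroupLike (M : V) : M ⟶ M ⊗ C.X := (ρ_ M).inv ≫ M ◁ g.g

theorem tensorGroupLike_naturality {M N : V} (f : M ⟶ N) :
    f ≫ tensorGroupLike g N = tensorGroupLike g M ≫ f ▷ C.X := by
  rw [tensorGroupLike, tensorGroupLike, Category.assoc, whisker_exchange,
    rightUnitor_inv_naturality_assoc]

theorem tensorGroupLike_counit (X : V) :
    tensorGroupLike g X ≫ X ◁ ε[C.X] ≫ (ρ_ X).hom = 𝟙 X := by
  rw [tensorGroupLike, Category.assoc, ← MonoidalCategory.whiskerLeft_comp_assoc, g.g_counit]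
  simp

/-- Since g_A is λ after inserting g, translating m ⊗ g by a inside the cofree module produces m
g_A(a). This links coinvariants of cofree modules with the Galois map. -/
theorem tensorGroupLike_act (M : RightMod A) :
    tensorGroupLike g M.X ▷ A.X ≫ (EntwinedModule.cofree E M).act = actCoact E g M := by
  simp [tensorGroupLike, actCoact, coactA]

theorem actCoact_naturality {M N : RightMod A} (f : M ⟶ N) :
    f.hom ▷ A.X ≫ actCoact E g N = actCoact E g M ≫ f.hom ▷ C.X := by
  have h := congr(M.X ◁ coactA E g ≫ (α_ M.X A.X C.X).inv ≫ $(f.act_hom) ▷ C.X)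
  simp only [comp_whiskerRight] at h
  rw [actCoact, actCoact, Category.assoc, Category.assoc, h, ← whisker_exchange_assoc]
  simp

/-- A is itself an entwined module, so g_A(aa') = g_A(a)a'. Hence m ⊗ a ↦ m g_A(a) is right
A-linear, as needed for `galoisHom`. -/
theorem actCoact_act (M : RightMod A) :
    M.X ◁ μ ≫ actCoact E g M =
      (α_ M.X A.X A.X).inv ≫ actCoact E g M ▷ A.X ≫ (EntwinedModule.cofree E M).act := by
  have h := congr(M.X ◁ $(coactA_mul E g) ≫ (α_ M.X A.X C.X).inv ≫ M.act ▷ C.X)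
  have h2 := M.act_mul_whisker C.X (𝟙 _)
  simp only [Category.comp_id] at h2
  simp [h2] at h
  simp [actCoact, ← h, exchange_inv₂]

/-- Associativity, (ma) g_A(a') = m (a g_A(a')). The bracket is the formula defining can, which is
how can enters `relShift_galoisMap`. -/
theorem act_actCoact (M : RightMod A) :
    M.act ▷ A.X ≫ actCoact E g M =
      (α_ M.X A.X A.X).hom ≫ M.X ◁ (A.X ◁ coactA E g ≫ (α_ A.X A.X C.X).inv ≫ μ ▷ C.X) ≫
        (α_ M.X A.X C.X).inv ≫ M.act ▷ C.X := by
  have h2 := M.act_mul_whisker C.X (𝟙 _)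
  simp only [Category.comp_id] at h2
  simp [actCoact, h2, ← whisker_exchange_assoc]

/-- Writing g_A(a) as a₀ ⊗ a₁, the left side is (m ⊗ g)a₀ ⊗ a₁ = m g_A(a₀) ⊗ a₁, and coassociativity
of g_A turns this into δ applied to the C factor of m g_A(a). -/
theorem actCoact_cofree (M : RightMod A) :
    tensorGroupLike g M.X ▷ A.X ≫ actCoact E g (EntwinedModule.cofree E M).toRightMod =
      actCoact E g M ≫ (EntwinedModule.cofree E M).coact := by
  have h := congr(M.X ◁ $(coactA_comul E g) ≫ (α_ M.X A.X (C.X ⊗ C.X)).inv ≫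
    M.act ▷ (C.X ⊗ C.X) ≫ (α_ M.X C.X C.X).inv)
  simp only [MonoidalCategory.whiskerLeft_comp, Category.assoc] at h
  have h2 : actCoact E g (EntwinedModule.cofree E M).toRightMod =
    (M.X ⊗ C.X) ◁ coactA E g ≫ (α_ (M.X ⊗ C.X) A.X C.X).inv ≫
      (EntwinedModule.cofree E M).act ▷ C.X := rfl
  rw [h2, ← whisker_exchange_assoc, associator_inv_naturality_left_assoc, ← comp_whiskerRight,
    tensorGroupLike_act]
  simp only [actCoact, Category.assoc]
  rw [← whisker_exchange_assoc, ← associator_inv_naturality_right_assoc, h]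
  simp

/-- The coaction of `m a` is `m g_A(a)` when `m` is coinvariant. -/
theorem act_coact_of_coinvariant (M : EntwinedModule E) {X : V} (f : X ⟶ M.X)
    (hf : f ≫ M.coact = f ≫ tensorGroupLike g M.X) :
    f ▷ A.X ≫ M.act ≫ M.coact = f ▷ A.X ≫ actCoact E g M.toRightMod := by
  -- The entwined compatibility reads ν(ma) = ν(m)a, and here ν(m) = m ⊗ g.
  rw [← tensorGroupLike_act, ← comp_whiskerRight_assoc, ← hf, ← M.act_coact]
  simp

section Coinvariants

variable [HasEqualizers V]

/-- For b coinvariant in A one has g_A(b) = b ⊗ g, whence m g_A(b) = mb ⊗ g. This gives both the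
B-linearity of m ↦ m ⊗ g and the stability of coinvariants under B. -/
theorem actCoact_coinvι (M : RightMod A) :
    M.X ◁ coinvι E g ≫ actCoact E g M =
      M.X ◁ coinvι E g ≫ M.act ≫ tensorGroupLike g M.X := by
  have h := congr(M.X ◁ $(coinvι_condition E g) ≫ (α_ M.X A.X C.X).inv ≫ M.act ▷ C.X)
  simp only [MonoidalCategory.whiskerLeft_comp, Category.assoc] at h
  rw [actCoact, h, tensorGroupLike_naturality, tensorGroupLike]
  simp

/-- The morphism `m ↦ m ⊗ g` of right modules over the coinvariants. -/
@[simps]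
def tensorGroupLikeHom (M : RightMod A) :
    M.restrict (coinvIncl E g) ⟶
      (EntwinedModule.cofree E M).toRightMod.restrict (coinvIncl E g) where
  hom := tensorGroupLike g M.X
  act_hom := by
    simp only [Category.assoc]
    -- For b in B: mb ⊗ g = m g_A(b) = (m ⊗ g)b.
    refine (actCoact_coinvι E g M).symm.trans ?_
    rw [← tensorGroupLike_act, ← whisker_exchange_assoc]

namespace EntwinedModule

variable {E} (M : EntwinedModule E)

/-- The object of coinvariants of an entwined module. -/
noncomputable def coinv : V := equalizer M.coact (tensorGroupLike g M.X)

/-- The inclusion of the coinvariants. -/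
noncomputable def coinvι : M.coinv g ⟶ M.X := equalizer.ι _ _

theorem coinvι_condition : M.coinvι g ≫ M.coact = M.coinvι g ≫ tensorGroupLike g M.X :=
  equalizer.condition _ _

instance : Mono (M.coinvι g) := inferInstanceAs (Mono (equalizer.ι _ _))

/-- The factorization of a morphism through the coinvariants. -/
noncomputable def coinvLift {X : V} (f : X ⟶ M.X) (hf : f ≫ M.coact = f ≫ tensorGroupLike g M.X) :
    X ⟶ M.coinv g :=
  equalizer.lift f hf

@[simp]
theorem coinvLift_ι {X : V} (f : X ⟶ M.X) (hf : f ≫ M.coact = f ≫ tensorGroupLike g M.X) :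
    M.coinvLift g f hf ≫ M.coinvι g = f :=
  equalizer.lift_ι _ _

/-- The right action of the coinvariants of `A` on the coinvariants of `M`. -/
noncomputable def coinvAct : M.coinv g ⊗ Entwining.coinv E g ⟶ M.coinv g :=
  M.coinvLift g (M.coinvι g ▷ _ ≫ M.X ◁ Entwining.coinvι E g ≫ M.act) (by
    -- For m coinvariant and b in B: ν(mb) = m g_A(b) = mb ⊗ g.
    rw [← whisker_exchange_assoc, Category.assoc, Category.assoc, Category.assoc, Category.assoc,
      act_coact_of_coinvariant E g M _ (M.coinvι_condition g), whisker_exchange_assoc,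
      whisker_exchange_assoc, actCoact_coinvι])

@[simp]
theorem coinvAct_ι : M.coinvAct g ≫ M.coinvι g =
    M.coinvι g ▷ _ ≫ M.X ◁ Entwining.coinvι E g ≫ M.act :=
  equalizer.lift_ι _ _

/-- The coinvariants of an entwined module, as a right module over the coinvariants of `A`. -/
@[simps]
noncomputable abbrev coinvMod : RightMod (coinvAlg E g) where
  X := M.coinv g
  act := M.coinvAct g
  act_one := by
    rw [← cancel_mono (M.coinvι g), Category.assoc, coinvAct_ι, whisker_exchange_assoc]
    refine congr(M.coinvι g ▷ 𝟙_ V ≫ $((M.toRightMod.restrict (coinvIncl E g)).act_one)).trans ?_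
    rw [rightUnitor_naturality]
  act_mul := by
    rw [← cancel_mono (M.coinvι g)]
    simp only [Category.assoc, coinvAct_ι]
    rw [whisker_exchange_assoc]
    refine congr(M.coinvι g ▷ _ ≫ $((M.toRightMod.restrict (coinvIncl E g)).act_mul)).trans ?_
    rw [← comp_whiskerRight_assoc, coinvAct_ι]
    simp

/-- The inclusion of the coinvariants as a morphism of modules. -/
@[simps]
noncomputable def coinvHom : M.coinvMod g ⟶ M.toRightMod.restrict (coinvIncl E g) where
  hom := M.coinvι g
  act_hom := M.coinvAct_ι g

/-- Flatness of A speaks of equalizers of B-modules, not of equalizers in V, so the fork defining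
the coinvariants is lifted to B-modules; this is possible because both legs are B-linear. -/
theorem coinvHom_condition :
    M.coinvHom g ≫ RightMod.restrictMap (coinvIncl E g) M.coactHom =
      M.coinvHom g ≫ tensorGroupLikeHom E g M.toRightMod :=
  RightMod.hom_ext _ _ (M.coinvι_condition g)

/-- The coinvariants form an equalizer of right modules over the coinvariants of `A`. -/
noncomputable def isLimitCoinvHom : IsLimit (Fork.ofι _ (M.coinvHom_condition g)) :=
  Fork.IsLimit.mk _
    (fun s =>
      { hom := M.coinvLift g s.ι.hom congr(RightMod.Hom.hom $(s.condition))
        act_hom := by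
          have h := s.ι.act_hom
          change s.pt.act ≫ M.coinvLift g s.ι.hom _ = M.coinvLift g s.ι.hom _ ▷ _ ≫ M.coinvAct g
          rw [← cancel_mono (M.coinvι g), Category.assoc, Category.assoc, coinvAct_ι,
            ← comp_whiskerRight_assoc, coinvLift_ι]
          exact h })
    (fun s => RightMod.hom_ext _ _ (M.coinvLift_ι g _ _))
    (fun s m hm => RightMod.hom_ext _ _ (by
      have h : m.hom ≫ M.coinvι g = s.ι.hom := congr(RightMod.Hom.hom $hm)
      change m.hom = M.coinvLift g s.ι.hom _
      rw [← cancel_mono (M.coinvι g), coinvLift_ι, h]))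

end EntwinedModule

/-- The morphism `m ↦ m ⊗ g` from `M` to the coinvariants of `M ⊗ C`. -/
noncomputable def cofreeCoinvLift (M : RightMod A) :
    M.restrict (coinvIncl E g) ⟶ (EntwinedModule.cofree E M).coinvMod g :=
  Fork.IsLimit.lift (EntwinedModule.isLimitCoinvHom g _) (tensorGroupLikeHom E g M) (by
    apply RightMod.hom_ext
    -- δg = g ⊗ g is exactly what makes m ⊗ g coinvariant for the coaction M ⊗ δ.
    have h := congr((ρ_ M.X).inv ≫ M.X ◁ $(g.g_comul) ≫ (α_ M.X C.X C.X).inv)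
    change tensorGroupLike g M.X ≫ M.X ◁ Δ ≫ (α_ M.X C.X C.X).inv =
      tensorGroupLike g M.X ≫ tensorGroupLike g (M.X ⊗ C.X)
    rw [tensorGroupLike_naturality]
    simp only [MonoidalCategory.whiskerLeft_comp, Category.assoc] at h
    rw [tensorGroupLike, Category.assoc, h]
    simp [MonoidalCategory.tensorHom_def'])

theorem cofreeCoinvLift_ι (M : RightMod A) :
    (cofreeCoinvLift E g M).hom ≫ (EntwinedModule.cofree E M).coinvι g =
      tensorGroupLike g M.X := by
  have h : cofreeCoinvLift E g M ≫ (EntwinedModule.cofree E M).coinvHom g =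
    tensorGroupLikeHom E g M := Fork.IsLimit.lift_ι _
  exact congr(RightMod.Hom.hom $h)

/-- The inverse applies ε to the factor C. One composite is the identity by εg = 1. For the other, a
coinvariant x of M ⊗ C satisfies (M ⊗ δ)x = x ⊗ g, and applying ε to the middle factor gives x = (M
⊗ ε)x ⊗ g. -/
instance (M : RightMod A) : IsIso (cofreeCoinvLift E g M) := by
  have : IsIso (cofreeCoinvLift E g M).hom := by
    refine ⟨(EntwinedModule.cofree E M).coinvι g ≫ M.X ◁ ε[C.X] ≫ (ρ_ M.X).hom, ?_, ?_⟩
    · rw [reassoc_of% (cofreeCoinvLift_ι E g M), tensorGroupLike_counit]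
    · rw [← cancel_mono ((EntwinedModule.cofree E M).coinvι g)]
      simp only [Category.assoc, cofreeCoinvLift_ι]
      have h := congr(M.X ◁ ($(ComonObj.counit_comul C.X) ≫ (λ_ C.X).hom))
      have h2 := tensorGroupLike_naturality g (M.X ◁ ε[C.X] ≫ (ρ_ M.X).hom)
      rw [Category.assoc] at h2
      rw [h2, ← reassoc_of% ((EntwinedModule.cofree E M).coinvι_condition g)]
      simp only [Category.assoc, Iso.inv_hom_id, MonoidalCategory.whiskerLeft_comp,
        MonoidalCategory.whiskerLeft_id] at h
      simp [h]
  exact RightMod.isIso_of_isIso_hom _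

end Coinvariants

end CoinvariantModules

/-! ### The adjunction between - ⊗_B A and coinvariants, and the Galois map M ⊗_B A ⟶ M ⊗ C. -/

section InducedAdjunction

variable {V : Type u} [Category.{v} V] [MonoidalCategory V]

section Unit

variable [HasCoequalizers V]
variable {A B : Mon V} (i : B ⟶ A)

/-- The morphism `X ⟶ X ⊗_B A`, `x ↦ x ⊗ 1`. -/
noncomputable def relUnit (X : RightMod B) : X.X ⟶ relTensor X (restrictLeft i) :=
  (ρ_ X.X).inv ≫ X.X ◁ η ≫ relπ X (restrictLeft i)

variable [∀ X : V, PreservesColimitsOfShape WalkingParallelPair (tensorRight X)]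

/-- (x ⊗ 1)a = x ⊗ a: the elements x ⊗ 1 generate X ⊗_B A over A, so an A-linear map out of it is
determined by its values on them. -/
theorem relUnit_actRight (X : RightMod B) :
    relUnit i X ▷ A.X ≫ relActRight X (restrictLeft i) = relπ X (restrictLeft i) := by
  rw [relUnit, comp_whiskerRight, comp_whiskerRight, Category.assoc, Category.assoc,
    relπ_actRight, associator_naturality_middle_assoc,
    ← MonoidalCategory.whiskerLeft_comp_assoc, MonObj.one_mul]
  simp

/-- Balancing gives xb ⊗ 1 = x ⊗ i(b) = (x ⊗ 1)i(b), that is, B-linearity of x ↦ x ⊗ 1. -/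
theorem act_relUnit (X : RightMod B) :
    X.act ≫ relUnit i X =
      relUnit i X ▷ B.X ≫ relTensor X (restrictLeft i) ◁ i.hom ≫
        relActRight X (restrictLeft i) := by
  rw [← whisker_exchange_assoc, relUnit_actRight, relUnit, rightUnitor_inv_naturality_assoc,
    ← whisker_exchange_assoc, relπ_condition]
  have h : B.X ◁ η[A.X] ≫ i.hom ▷ A.X ≫ μ = (ρ_ _).hom ≫ i.hom := by
    rw [whisker_exchange_assoc, MonObj.mul_one, rightUnitor_naturality]
  have h2 := congr((ρ_ (X.X ⊗ B.X)).inv ≫ (α_ X.X B.X (𝟙_ V)).hom ≫ X.X ◁ $h ≫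
    relπ X (restrictLeft i))
  simp at h2 ⊢
  exact h2

end Unit

variable {C : Comon V} {A : Mon V} (E : EntwiningStructure C A) (g : GroupLike C)
variable [HasEqualizers V]

/-- B-linearity of h makes x ⊗ a ↦ h(x)a well defined on X ⊗_B A: h(xb)a = (h(x)b)a = h(x)(ba). -/
theorem inducedDesc_balance {E : EntwiningStructure C A} {X : RightMod (coinvAlg E g)} {M : EntwinedModule E}
    (h : X ⟶ M.coinvMod g) :
    X.act ▷ A.X ≫ (h.hom ≫ M.coinvι g) ▷ A.X ≫ M.act =
      (α_ X.X (coinv E g) A.X).hom ≫ X.X ◁ (coinvι E g ▷ A.X ≫ μ) ≫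
        (h.hom ≫ M.coinvι g) ▷ A.X ≫ M.act := by
  have h1 := (h ≫ M.coinvHom g).act_hom
  have h2 := M.act_mul
  rw [RightMod.comp_hom, EntwinedModule.coinvHom_hom] at h1
  rw [← comp_whiskerRight_assoc, h1, whisker_exchange_assoc]
  simp [h2]

variable [HasCoequalizers V]

/-- Because g_A(1) = 1 ⊗ g, the elements x ⊗ 1 are coinvariant. -/
theorem relUnit_inducedCoact (X : RightMod (coinvAlg E g)) :
    relUnit (coinvIncl E g) X ≫ inducedCoact E g X =
      relUnit (coinvIncl E g) X ≫ tensorGroupLike g _ := by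
  rw [relUnit, Category.assoc, Category.assoc, relπ_inducedCoact, Category.assoc, Category.assoc,
    tensorGroupLike_naturality]
  have h := congr(X.X ◁ $(one_coactA E g))
  simp only [MonoidalCategory.whiskerLeft_comp] at h
  rw [reassoc_of% h, tensorGroupLike]
  simp

/-- The morphism `M ⊗_B A ⟶ M ⊗ C`, `m ⊗ a ↦ m g_A(a)`, where `B = A^C`. -/
noncomputable def galoisMap (M : RightMod A) :
    relTensor (M.restrict (coinvIncl E g)) (restrictLeft (coinvIncl E g)) ⟶ M.X ⊗ C.X :=
  relDesc _ _ (actCoact E g M) (by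
    -- Balanced over B because g_A(ba) = b g_A(a) for b in B.
    have h := congr(M.X ◁ $(coinv_coactA E g) ≫ (α_ M.X A.X C.X).inv ≫ M.act ▷ C.X)
    have h2 := act_actCoact E g M
    dsimp only
    rw [comp_whiskerRight, Category.assoc, h2]
    simp only [MonoidalCategory.whiskerLeft_comp, Category.assoc] at h ⊢
    rw [actCoact, h]
    simp)

theorem relπ_galoisMap (M : RightMod A) :
    relπ (M.restrict (coinvIncl E g)) (restrictLeft (coinvIncl E g)) ≫ galoisMap E g M =
      actCoact E g M :=
  relπ_desc _ _ _ _

/-- Used with f the coaction ν: the Galois maps turn ν ⊗_B A into ν ⊗ C. -/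
theorem galoisMap_naturality {M N : RightMod A} (f : M ⟶ N) :
    relMap (RightMod.restrictMap (coinvIncl E g) f) (𝟙 (restrictLeft (coinvIncl E g))) ≫
      galoisMap E g N = galoisMap E g M ≫ f.hom ▷ C.X := by
  apply rel_ext
  have h := relπ_map (RightMod.restrictMap (coinvIncl E g) f) (𝟙 (restrictLeft (coinvIncl E g)))
  rw [reassoc_of% h, relπ_galoisMap, ← Category.assoc, relπ_galoisMap, Bimod.id_hom',
    tensorHom_id]
  exact actCoact_naturality E g f

/-- By comultiplicativity of g_A, the Galois maps turn the other leg of the fork, induced by m ↦ m ⊗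
g, into M ⊗ δ. -/
theorem galoisMap_cofree (M : RightMod A) :
    relMap (tensorGroupLikeHom E g M) (𝟙 (restrictLeft (coinvIncl E g))) ≫
      galoisMap E g (EntwinedModule.cofree E M).toRightMod =
        galoisMap E g M ≫ (EntwinedModule.cofree E M).coact := by
  apply rel_ext
  have h := relπ_map (tensorGroupLikeHom E g M) (𝟙 (restrictLeft (coinvIncl E g)))
  rw [reassoc_of% h, relπ_galoisMap, Bimod.id_hom', tensorHom_id]
  refine (actCoact_cofree E g M).trans ?_
  rw [← relπ_galoisMap, Category.assoc]

variable [∀ X : V, PreservesColimitsOfShape WalkingParallelPair (tensorRight X)]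

/-- The morphism `m ⊗ a ↦ m g_A(a)` as a morphism of right modules. -/
noncomputable def galoisHom (M : RightMod A) :
    relMod (M.restrict (coinvIncl E g)) (restrictLeft (coinvIncl E g)) ⟶
      (EntwinedModule.cofree E M).toRightMod where
  hom := galoisMap E g M
  act_hom := by
    rw [← cancel_epi (relπ (M.restrict (coinvIncl E g)) (restrictLeft (coinvIncl E g)) ▷ A.X),
      relπ_actRight_assoc, relπ_galoisMap, ← comp_whiskerRight_assoc, relπ_galoisMap]
    exact congr((α_ M.X A.X A.X).hom ≫ $(actCoact_act E g M)).trans (Iso.hom_inv_id_assoc _ _)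

section Adjunction

/-- The entwined module `X ⊗_B A`, the value of the induced functor at `X`. -/
noncomputable abbrev inducedObj (X : RightMod (coinvAlg E g)) : EntwinedModule E where
  toRightMod := relMod X (restrictLeft (coinvIncl E g))
  coact := inducedCoact E g X
  coact_counit := inducedCoact_counit E g X
  coact_comul := inducedCoact_comul E g X
  act_coact := inducedCoact_act E g X

variable {E}

/-- The morphism `X ⊗_B A ⟶ M` of entwined modules corresponding to `X ⟶ M^C`. -/
noncomputable def inducedDesc {X : RightMod (coinvAlg E g)} {M : EntwinedModule E}
    (h : X ⟶ M.coinvMod g) : inducedObj E g X ⟶ M where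
  hom := relDesc X (restrictLeft (coinvIncl E g)) ((h.hom ≫ M.coinvι g) ▷ A.X ≫ M.act)
    (inducedDesc_balance g h)
  act_hom := by
    rw [← cancel_epi (relπ X (restrictLeft (coinvIncl E g)) ▷ A.X)]
    refine (relπ_actRight_assoc _ _ _).trans ?_
    rw [← comp_whiskerRight_assoc, relπ_desc, whisker_exchange_assoc, M.act_mul]
    simp
  coact_hom := by
    have h3 := act_coact_of_coinvariant E g M (h.hom ≫ M.coinvι g)
      (by rw [Category.assoc, Category.assoc, M.coinvι_condition])
    apply rel_ext
    rw [relπ_desc_assoc, Category.assoc, h3]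
    rw [reassoc_of% (relπ_inducedCoact E g X), ← comp_whiskerRight, relπ_desc, actCoact, ← whisker_exchange_assoc]
    simp

theorem relπ_inducedDesc {X : RightMod (coinvAlg E g)} {M : EntwinedModule E}
    (h : X ⟶ M.coinvMod g) : relπ X (restrictLeft (coinvIncl E g)) ≫ (inducedDesc g h).hom =
      (h.hom ≫ M.coinvι g) ▷ A.X ≫ M.act :=
  relπ_desc _ _ _ (inducedDesc_balance g h)

theorem relUnit_inducedDesc {X : RightMod (coinvAlg E g)} {M : EntwinedModule E}
    (h : X ⟶ M.coinvMod g) : relUnit (coinvIncl E g) X ≫ (inducedDesc g h).hom =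
      h.hom ≫ M.coinvι g := by
  rw [relUnit, Category.assoc, Category.assoc, relπ_inducedDesc, whisker_exchange_assoc, M.act_one]
  simp

/-- A colinear map sends the coinvariant elements x ⊗ 1 to coinvariants, so its restriction to them
factors through the coinvariants of M. -/
theorem relUnit_coinvariant {X : RightMod (coinvAlg E g)} {M : EntwinedModule E}
    (f : inducedObj E g X ⟶ M) :
    (relUnit (coinvIncl E g) X ≫ f.hom) ≫ M.coact =
      (relUnit (coinvIncl E g) X ≫ f.hom) ≫ tensorGroupLike g M.X := by
  have h := f.coact_hom
  have h2 := congr($(relUnit_inducedCoact E g X) ≫ f.hom ▷ C.X)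
  rw [Category.assoc, Category.assoc, ← tensorGroupLike_naturality, h] at h2
  rw [Category.assoc, Category.assoc, h2]

/-- The morphism `X ⟶ M^C` of modules corresponding to `X ⊗_B A ⟶ M`. -/
noncomputable def inducedLift {X : RightMod (coinvAlg E g)} {M : EntwinedModule E}
    (f : inducedObj E g X ⟶ M) : X ⟶ M.coinvMod g where
  hom := M.coinvLift g (relUnit (coinvIncl E g) X ≫ f.hom) (relUnit_coinvariant g f)
  act_hom := by
    have h := congr(relTensor X (restrictLeft (coinvIncl E g)) ◁ coinvι E g ≫ $(f.act_hom))
    have h2 := congr($(act_relUnit (coinvIncl E g) X) ≫ f.hom)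
    rw [← cancel_mono (M.coinvι g), Category.assoc, Category.assoc, EntwinedModule.coinvLift_ι,
      M.coinvAct_ι, ← comp_whiskerRight_assoc, EntwinedModule.coinvLift_ι]
    simp only [Category.assoc] at h2
    rw [h2, h, comp_whiskerRight, Category.assoc]
    simp only [whisker_exchange_assoc]

variable (E) in
/-- The adjunction between the functor `- ⊗_B A` and the coinvariants functor, on morphisms. -/
noncomputable def inducedHomEquiv (X : RightMod (coinvAlg E g)) (M : EntwinedModule E) :
    (inducedObj E g X ⟶ M) ≃ (X ⟶ M.coinvMod g) where
  toFun f := inducedLift g f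
  invFun h := inducedDesc g h
  left_inv f := by
    apply EntwinedModule.hom_ext
    apply rel_ext
    refine (relπ_inducedDesc g _).trans ?_
    have h : (inducedLift g f).hom ≫ M.coinvι g = relUnit (coinvIncl E g) X ≫ f.hom :=
      M.coinvLift_ι g _ _
    have h2 : _ = f.hom ▷ A.X ≫ M.act := f.act_hom
    -- f(x ⊗ 1)a = f(x ⊗ a) by A-linearity.
    rw [h, comp_whiskerRight, Category.assoc, ← h2, ← relUnit_actRight, Category.assoc]
  right_inv h := by
    apply RightMod.hom_ext
    rw [← cancel_mono (M.coinvι g)]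
    exact (M.coinvLift_ι g _ _).trans (relUnit_inducedDesc g h)

variable (E) in
-- Naturality in the B-module alone suffices: the action of the right adjoint on morphisms is then
-- obtained by transport along the bijections.
theorem inducedHomEquiv_naturality (X X' : RightMod (coinvAlg E g)) (M : EntwinedModule E)
    (f : X' ⟶ X) (h : X ⟶ M.coinvMod g) :
    inducedDesc g (f ≫ h) =
      (show inducedObj E g X' ⟶ inducedObj E g X from (inducedFunctor E g).map f) ≫
        inducedDesc g h := by
  apply EntwinedModule.hom_ext
  apply rel_ext
  refine (relπ_inducedDesc g _).trans ?_
  refine Eq.trans ?_ (relπ_map_assoc f (𝟙 (restrictLeft (coinvIncl E g))) _).symm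
  rw [relπ_inducedDesc, Bimod.id_hom', tensorHom_id]
  simp

variable (E) in
/-- The adjunction between the functor `- ⊗_B A` and the coinvariants functor. -/
noncomputable def inducedAdj :
    inducedFunctor E g ⊣ Adjunction.rightAdjointOfEquiv (F := inducedFunctor E g)
      (inducedHomEquiv E g)
      (fun X' X M f h => by
        -- Naturality is known for the inverse bijection; applying it to the transpose of h gives
        -- the forward form.
        have h2 := inducedHomEquiv_naturality E g X X' M f (inducedHomEquiv E g X M h)
        have h3 : inducedDesc g (inducedHomEquiv E g X M h) = h :=
          (inducedHomEquiv E g X M).left_inv h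
        rw [h3] at h2
        have h4 := (inducedHomEquiv E g X' M).right_inv (f ≫ inducedHomEquiv E g X M h)
        exact congr(inducedHomEquiv E g X' M $(h2.symm)).trans h4) :=
  Adjunction.adjunctionOfEquivRight _ _

/-- The counit is the transpose of an identity, hence m ⊗ a ↦ ma; both directions of the theorem
test its invertibility in this explicit form. -/
theorem inducedAdj_counit (M : EntwinedModule E) :
    (inducedAdj E g).counit.app M = inducedDesc g (𝟙 (M.coinvMod g)) :=
  Adjunction.adjunctionOfEquivRight_counit_app _ _ _

end Adjunction

end InducedAdjunction

/-! ### The Galois map as M ⊗_A can. -/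

section GaloisMap

variable {V : Type u} [Category.{v} V] [MonoidalCategory V]

section Shift

variable [HasCoequalizers V]
variable [∀ X : V, PreservesColimitsOfShape WalkingParallelPair (tensorLeft X)]
variable [∀ X : V, PreservesColimitsOfShape WalkingParallelPair (tensorRight X)]
/-- A morphism of corings whose underlying morphism is invertible is invertible. -/
theorem Coring.isIso_of_isIso_hom {A : Mon V} {D D' : Coring A} (f : D ⟶ D') [IsIso f.hom.hom] : IsIso f := by
  let k : D'.M ⟶ D.M :=
    { hom := inv f.hom.hom
      left_act_hom := by
        rw [← cancel_epi (A.X ◁ f.hom.hom), ← reassoc_of% f.hom.left_act_hom,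
          ← MonoidalCategory.whiskerLeft_comp_assoc]
        simp
      right_act_hom := by
        rw [← cancel_epi (f.hom.hom ▷ A.X), ← reassoc_of% f.hom.right_act_hom,
          ← comp_whiskerRight_assoc]
        simp }
  have h1 : f.hom ≫ k = 𝟙 _ := Bimod.hom_ext _ _ (IsIso.hom_inv_id f.hom.hom)
  have h2 : k ≫ f.hom = 𝟙 _ := Bimod.hom_ext _ _ (IsIso.inv_hom_id f.hom.hom)
  refine ⟨{ hom := k, counit_hom := ?_, comul_hom := ?_ }, Coring.Hom.ext h1, Coring.Hom.ext h2⟩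
  · rw [← f.counit_hom, reassoc_of% h2]
  · have h3 : D'.comul = k ≫ f.hom ≫ D'.comul := by rw [reassoc_of% h2]
    rw [h3, ← f.comul_hom, Category.assoc, Category.assoc, ← relBimodMap_comp, h1,
      relBimodMap_id, Category.comp_id]

variable {A B : Mon V} (i : B ⟶ A) (M : RightMod A)

/-- The morphism `M ⊗ (A ⊗_B A) ⟶ M ⊗_B A`, `m ⊗ a ⊗ a' ↦ m a ⊗ a'`. -/
noncomputable def relShift :
    M.X ⊗ (sweedlerBimod i).X ⟶ relTensor (M.restrict i) (restrictLeft i) :=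
  relDescLeft (.ofBimod (restrictRight i)) (restrictLeft i) M.X
    ((α_ M.X A.X A.X).inv ≫ M.act ▷ A.X ≫ relπ (M.restrict i) (restrictLeft i)) (by
      -- m(a i(b)) = (ma)i(b), so balancing over B is respected.
      have h : M.X ◁ (A.X ◁ i.hom ≫ μ) ≫ M.act =
          (α_ M.X A.X B.X).inv ≫ M.act ▷ B.X ≫ (M.restrict i).act := by
        rw [MonoidalCategory.whiskerLeft_comp, Category.assoc, M.act_mul, exchange_inv]
      have h2 := relπ_condition (M.restrict i) (restrictLeft i)
      rw [associator_inv_naturality_middle_assoc, ← comp_whiskerRight_assoc, h,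
        comp_whiskerRight_assoc, comp_whiskerRight_assoc, h2, exchange_inv]
      simp)

theorem sweedlerπ_relShift :
    M.X ◁ sweedlerπ i ≫ relShift i M =
      (α_ M.X A.X A.X).inv ≫ M.act ▷ A.X ≫ relπ (M.restrict i) (restrictLeft i) :=
  relπ_descLeft _ _ _ _ _

theorem sweedlerInr_relShift :
    M.X ◁ sweedlerInr i ≫ relShift i M = relπ (M.restrict i) (restrictLeft i) := by
  rw [sweedlerInr, MonoidalCategory.whiskerLeft_comp, MonoidalCategory.whiskerLeft_comp,
    Category.assoc, Category.assoc, sweedlerπ_relShift, associator_inv_naturality_middle_assoc,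
    ← comp_whiskerRight_assoc, M.act_one]
  simp

/-- Associativity of the action on M makes the shift A-balanced. It thus stands in for the canonical
isomorphism M ⊗_A (A ⊗_B A) ≅ M ⊗_B A without forming the left-hand tensor product. -/
theorem act_relShift :
    M.act ▷ (sweedlerBimod i).X ≫ relShift i M =
      (α_ M.X A.X (sweedlerBimod i).X).hom ≫ M.X ◁ (sweedlerBimod i).actLeft ≫
        relShift i M := by
  have h := congr(M.X ◁ $(sweedlerπ_actLeft i) ≫ relShift i M)
  simp only [MonoidalCategory.whiskerLeft_comp, Category.assoc, sweedlerπ_relShift] at h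
  rw [← cancel_epi ((M.X ⊗ A.X) ◁ sweedlerπ i), whisker_exchange_assoc, sweedlerπ_relShift,
    tensor_whiskerLeft, Category.assoc, Category.assoc, Iso.inv_hom_id_assoc, h,
    associator_inv_naturality_middle_assoc, ← comp_whiskerRight_assoc, M.act_mul]
  simp

end Shift

variable {C : Comon V} {A : Mon V} (E : EntwiningStructure C A) (g : GroupLike C)
variable [HasEqualizers V] [HasCoequalizers V]
variable [∀ X : V, PreservesColimitsOfShape WalkingParallelPair (tensorLeft X)]
variable [∀ X : V, PreservesColimitsOfShape WalkingParallelPair (tensorRight X)]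

section Galois

/-- On m ⊗ a ⊗ a' both sides are m (a g_A(a')). Up to the shift, the Galois map of M is therefore M
⊗_A can. -/
theorem relShift_galoisMap (M : RightMod A) :
    relShift (coinvIncl E g) M ≫ galoisMap E g M =
      M.X ◁ canMor E g ≫ (α_ M.X A.X C.X).inv ≫ M.act ▷ C.X := by
  rw [← cancel_epi (M.X ◁ sweedlerπ (coinvIncl E g)), reassoc_of% sweedlerπ_relShift,
    relπ_galoisMap, act_actCoact, ← sweedlerπ_can]
  simp

/-- If `can` is invertible, so is `M ⊗_B A ⟶ M ⊗ C` for every right `A`-module `M`. -/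
theorem galoisMap_isIso [IsIso (canMor E g)] (M : RightMod A) : IsIso (galoisMap E g M) := by
  -- The inverse sends m ⊗ c to m · can⁻¹(1 ⊗ c).
  refine ⟨M.X ◁ (entInr C A ≫ inv (canMor E g)) ≫ relShift (coinvIncl E g) M, ?_, ?_⟩
  -- Left linearity of can gives a · can⁻¹(1 ⊗ c) = can⁻¹(a ⊗ c), so with g_A(a) in place of a ⊗ c
  -- the composite sends m ⊗ a to m · can⁻¹(g_A(a)).
  · have h1 : A.X ◁ (entInr C A ≫ inv (canMor E g)) ≫
        (sweedlerBimod (coinvIncl E g)).actLeft = inv (canMor E g) := by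
      rw [← cancel_mono (canMor E g), Category.assoc, can_left,
        ← MonoidalCategory.whiskerLeft_comp_assoc, Category.assoc, IsIso.inv_hom_id,
        Category.comp_id, entInr_actLeft]
    -- can(1 ⊗ a) = g_A(a), and m · (1 ⊗ a) = m ⊗ a.
    have h2 : coactA E g ≫ inv (canMor E g) = sweedlerInr (coinvIncl E g) := by
      rw [← sweedlerInr_can, Category.assoc, IsIso.hom_inv_id, Category.comp_id]
    apply rel_ext
    rw [reassoc_of% relπ_galoisMap, Category.comp_id, actCoact, Category.assoc, Category.assoc,
      ← whisker_exchange_assoc, act_relShift, tensor_whiskerLeft]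
    simp only [Category.assoc, Iso.inv_hom_id_assoc]
    rw [← MonoidalCategory.whiskerLeft_comp_assoc M.X (A.X ◁ _), h1,
      ← MonoidalCategory.whiskerLeft_comp_assoc, h2, sweedlerInr_relShift]
  · rw [Category.assoc, relShift_galoisMap, ← MonoidalCategory.whiskerLeft_comp_assoc,
      Category.assoc, IsIso.inv_hom_id, Category.comp_id, entInr]
    simp [M.act_one_whisker]

theorem isIso_canMor_of_isGalois (h : IsGalois E g) : IsIso (canMor E g) := by
  have : IsIso (can E g) := h
  have h1 := congr(Bimod.Hom.hom (Coring.Hom.hom $(IsIso.hom_inv_id (can E g))))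
  have h2 := congr(Bimod.Hom.hom (Coring.Hom.hom $(IsIso.inv_hom_id (can E g))))
  exact ⟨(inv (can E g)).hom.hom, h1, h2⟩

theorem isGalois_of_isIso_canMor [IsIso (canMor E g)] : IsGalois E g :=
  have : IsIso (can E g).hom.hom := inferInstanceAs (IsIso (canMor E g))
  Coring.isIso_of_isIso_hom (can E g)

end Galois

end GaloisMap

section GaloisEquivalence

variable {V : Type u} [Category.{v} V] [MonoidalCategory V]

variable {C : Comon V} {A : Mon V} (E : EntwiningStructure C A) (g : GroupLike C)

/-! ### For flat C, equalizers of entwined modules are computed in V. -/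

section ForgetEqualizers

variable [HasEqualizers V]

namespace RightMod

variable {M N : RightMod A} (f h : M ⟶ N)

/-- The equalizer of two morphisms of right modules. -/
@[simps]
noncomputable abbrev equalizerMod : RightMod A where
  X := equalizer f.hom h.hom
  act := equalizer.lift (equalizer.ι f.hom h.hom ▷ A.X ≫ M.act) (by
    rw [Category.assoc, Category.assoc, f.act_hom, h.act_hom, ← comp_whiskerRight_assoc,
      equalizer.condition, comp_whiskerRight_assoc])
  act_one := by
    rw [← cancel_mono (equalizer.ι f.hom h.hom), Category.assoc, equalizer.lift_ι,
      whisker_exchange_assoc, M.act_one, rightUnitor_naturality]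
  act_mul := by
    rw [← cancel_mono (equalizer.ι f.hom h.hom), Category.assoc, equalizer.lift_ι,
      whisker_exchange_assoc, M.act_mul, Category.assoc, Category.assoc, equalizer.lift_ι,
      ← comp_whiskerRight_assoc, equalizer.lift_ι]
    simp

/-- The inclusion of the equalizer of two morphisms of right modules. -/
@[simps]
noncomputable def equalizerι : equalizerMod f h ⟶ M where
  hom := equalizer.ι f.hom h.hom
  act_hom := equalizer.lift_ι _ _

theorem equalizerι_condition : equalizerι f h ≫ f = equalizerι f h ≫ h :=
  hom_ext _ _ (equalizer.condition f.hom h.hom)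

/-- The equalizer of the underlying morphisms is an equalizer of right modules. -/
noncomputable def isLimitEqualizerι : IsLimit (Fork.ofι _ (equalizerι_condition f h)) :=
  Fork.IsLimit.mk _
    (fun s =>
      { hom := equalizer.lift s.ι.hom congr(Hom.hom $(s.condition))
        act_hom := by
          have h1 := s.ι.act_hom
          change s.pt.act ≫ equalizer.lift (f := f.hom) (g := h.hom) s.ι.hom _ =
            equalizer.lift (f := f.hom) (g := h.hom) s.ι.hom _ ▷ _ ≫ (equalizerMod f h).act
          rw [← cancel_mono (equalizer.ι f.hom h.hom), Category.assoc, Category.assoc,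
            equalizer.lift_ι, equalizer.lift_ι, ← comp_whiskerRight_assoc, equalizer.lift_ι]
          exact h1 })
    (fun s => hom_ext _ _ (equalizer.lift_ι _ _))
    (fun s m hm => hom_ext _ _ (by
      have h1 : m.hom ≫ equalizer.ι f.hom h.hom = s.ι.hom := congr(Hom.hom $hm)
      change m.hom = equalizer.lift (f := f.hom) (g := h.hom) s.ι.hom _
      rw [← cancel_mono (equalizer.ι f.hom h.hom), equalizer.lift_ι, h1]))

end RightMod

namespace EntwinedModule

variable {E} {M N : EntwinedModule E} (f h : M ⟶ N)

/-- If `C` is flat, then `- ⊗ C` maps equalizers to equalizers. -/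
theorem isLimitWhisker [PreservesLimitsOfShape WalkingParallelPair (tensorRight C.X)]
    {X Y : V} (f h : X ⟶ Y) :
    Nonempty (IsLimit (Fork.ofι (equalizer.ι f h ▷ C.X)
      (show _ ≫ f ▷ C.X = _ ≫ h ▷ C.X by
        rw [← comp_whiskerRight, ← comp_whiskerRight, equalizer.condition]))) :=
  ⟨isLimitForkMapOfIsLimit (tensorRight C.X) _ (equalizerIsEqualizer f h)⟩

variable [PreservesLimitsOfShape WalkingParallelPair (tensorRight C.X)]

instance equalizerι_whiskerRight_mono {X Y : V} (f h : X ⟶ Y) :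
    Mono (equalizer.ι f h ▷ C.X) :=
  mono_of_isLimit_fork (isLimitWhisker f h).some

/-- Flatness used twice: coassociativity on an equalizer takes values in a twofold tensor product
with C and is checked there after the inclusion into M. -/
instance equalizerι_whiskerRight_whiskerRight_mono {X Y : V} (f h : X ⟶ Y) :
    Mono (equalizer.ι f h ▷ C.X ▷ C.X) :=
  mono_of_isLimit_fork
    (isLimitForkMapOfIsLimit (tensorRight C.X) _ (isLimitWhisker f h).some)

/-- The coaction on the equalizer of two morphisms of entwined modules. -/
noncomputable def equalizerCoact :
    equalizer f.hom h.hom ⟶ equalizer f.hom h.hom ⊗ C.X :=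
  Fork.IsLimit.lift (isLimitWhisker f.hom h.hom).some (equalizer.ι f.hom h.hom ≫ M.coact) (by
    -- Colinearity of f and h shows that ν, restricted to their equalizer, equalizes f ⊗ C and h ⊗
    -- C.
    rw [Category.assoc, Category.assoc, f.coact_hom, h.coact_hom, ← Category.assoc,
      equalizer.condition, Category.assoc])

theorem equalizerCoact_ι :
    equalizerCoact f h ≫ equalizer.ι f.hom h.hom ▷ C.X = equalizer.ι f.hom h.hom ≫ M.coact :=
  Fork.IsLimit.lift_ι (isLimitWhisker f.hom h.hom).some

/-- The equalizer of two morphisms of entwined modules. -/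
noncomputable abbrev equalizerObj : EntwinedModule E where
  toRightMod := RightMod.equalizerMod (toRightModHom f) (toRightModHom h)
  coact := equalizerCoact f h
  coact_counit := by
    have : Mono ((ρ_ (equalizer f.hom h.hom)).hom ≫ equalizer.ι f.hom h.hom) := inferInstance
    rw [← cancel_mono ((ρ_ (equalizer f.hom h.hom)).hom ≫ equalizer.ι f.hom h.hom),
      ← rightUnitor_naturality, Category.assoc, whisker_exchange_assoc,
      reassoc_of% (equalizerCoact_ι f h), reassoc_of% M.coact_counit, rightUnitor_naturality]
    simp
  coact_comul := by
    rw [← cancel_mono ((α_ _ _ _).inv ≫ equalizer.ι f.hom h.hom ▷ C.X ▷ C.X)]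
    have h1 := congr(equalizerCoact f h ≫ $(equalizerCoact_ι f h) ▷ C.X)
    have h2 := congr(equalizer.ι f.hom h.hom ≫ $(M.coact_comul) ≫ (α_ M.X C.X C.X).inv)
    simp only [comp_whiskerRight, reassoc_of% (equalizerCoact_ι f h)] at h1
    simp only [Category.assoc, Iso.hom_inv_id, Category.comp_id] at h2
    simp only [Category.assoc, Iso.hom_inv_id_assoc]
    rw [h1, ← h2, ← associator_inv_naturality_left, whisker_exchange_assoc,
      reassoc_of% (equalizerCoact_ι f h)]
  act_coact := by
    have h1 : (RightMod.equalizerMod (toRightModHom f) (toRightModHom h)).act ≫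
      equalizer.ι f.hom h.hom = _ := equalizer.lift_ι _ _
    have h2 := congr($h1 ▷ C.X)
    have h3 := congr($(equalizerCoact_ι f h) ▷ A.X)
    simp only [comp_whiskerRight] at h2 h3
    rw [← cancel_mono (equalizer.ι f.hom h.hom ▷ C.X)]
    simp only [Category.assoc, RightMod.equalizerMod_X]
    rw [h2, equalizerCoact_ι, reassoc_of% h1, ← M.act_coact, ← reassoc_of% h3,
      ← associator_inv_naturality_left_assoc, whisker_exchange_assoc,
      associator_naturality_left_assoc]

/-- The inclusion of the equalizer of two morphisms of entwined modules. -/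
@[simps]
noncomputable def equalizerHom : equalizerObj f h ⟶ M where
  hom := equalizer.ι f.hom h.hom
  act_hom := (RightMod.equalizerι (toRightModHom f) (toRightModHom h)).act_hom
  coact_hom := equalizerCoact_ι f h

theorem equalizerHom_condition : equalizerHom f h ≫ f = equalizerHom f h ≫ h :=
  hom_ext _ _ (equalizer.condition f.hom h.hom)

/-- The equalizer of the underlying morphisms is an equalizer of entwined modules. -/
noncomputable def isLimitEqualizerHom : IsLimit (Fork.ofι _ (equalizerHom_condition f h)) :=
  Fork.IsLimit.mk _
    (fun s =>
      have hι : equalizer.lift (f := f.hom) (g := h.hom) s.ι.hom congr(Hom.hom $(s.condition)) ≫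
        equalizer.ι f.hom h.hom = s.ι.hom := equalizer.lift_ι _ _
      { hom := equalizer.lift (f := f.hom) (g := h.hom) s.ι.hom congr(Hom.hom $(s.condition))
        act_hom := by
          have h1 : s.pt.act ≫ s.ι.hom = s.ι.hom ▷ A.X ≫ M.act := s.ι.act_hom
          have h2 : (equalizerObj f h).act ≫ _ = _ := (equalizerHom f h).act_hom
          rw [equalizerHom_hom] at h2
          change s.pt.act ≫ equalizer.lift (f := f.hom) (g := h.hom) s.ι.hom _ =
            equalizer.lift (f := f.hom) (g := h.hom) s.ι.hom _ ▷ _ ≫ (equalizerObj f h).act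
          rw [← cancel_mono (equalizer.ι f.hom h.hom), Category.assoc, Category.assoc, hι, h2,
            ← comp_whiskerRight_assoc, hι, h1]
        coact_hom := by
          have h1 : s.pt.coact ≫ s.ι.hom ▷ C.X = s.ι.hom ≫ M.coact := s.ι.coact_hom
          change s.pt.coact ≫ equalizer.lift (f := f.hom) (g := h.hom) s.ι.hom _ ▷ C.X =
            equalizer.lift (f := f.hom) (g := h.hom) s.ι.hom _ ≫ equalizerCoact f h
          rw [← cancel_mono (equalizer.ι f.hom h.hom ▷ C.X), Category.assoc, Category.assoc,
            ← comp_whiskerRight, hι, equalizerCoact_ι, ← Category.assoc (equalizer.lift _ _), hι,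
            h1] })
    (fun s => hom_ext _ _ (equalizer.lift_ι _ _))
    (fun s m hm => hom_ext _ _ (by
      have h1 : m.hom ≫ equalizer.ι f.hom h.hom = s.ι.hom := congr(Hom.hom $hm)
      exact equalizer.hom_ext (h1.trans (equalizer.lift_ι _ _).symm)))

/-- Equalizers of entwined modules and of A-modules have the same underlying equalizer in V, so one
explicit limit cone maps to the other. A general diagram of this shape is isomorphic to a parallel
pair. -/
instance : PreservesLimitsOfShape WalkingParallelPair (forget E) where
  preservesLimit {K} := by
    have h1 : PreservesLimit (parallelPair (K.map .left) (K.map .right)) (forget E) :=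
      preservesLimit_of_preserves_limit_cone
        (isLimitEqualizerHom (K.map .left) (K.map .right))
        ((isLimitMapConeForkEquiv (forget E) (equalizerHom_condition _ _)).symm
          (RightMod.isLimitEqualizerι _ _))
    exact preservesLimit_of_iso_diagram (forget E) (diagramIsoParallelPair K).symm

end EntwinedModule

end ForgetEqualizers

variable [HasEqualizers V] [HasCoequalizers V]
variable [∀ X : V, PreservesColimitsOfShape WalkingParallelPair (tensorRight X)]

/-! ### Invertibility of the counit from flatness of A and the Galois isomorphisms. -/

section Counit

variable {E} (M : EntwinedModule E)

/-- ν(ma) = m g_A(a) for coinvariant m. This square exhibits the counit as the comparison between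
the fork M^C ⊗_B A ⟶ M ⊗_B A and the fork ν : M ⟶ M ⊗ C. -/
theorem inducedDesc_id_coact :
    (inducedDesc g (𝟙 (M.coinvMod g))).hom ≫ M.coact =
      relMap (M.coinvHom g) (𝟙 (restrictLeft (coinvIncl E g))) ≫ galoisMap E g M.toRightMod := by
  have h := relπ_map (M.coinvHom g) (𝟙 (restrictLeft (coinvIncl E g)))
  apply rel_ext
  rw [reassoc_of% h, relπ_galoisMap, ← Category.assoc, relπ_inducedDesc, Category.assoc,
    RightMod.id_hom, Category.id_comp, Bimod.id_hom', tensorHom_id,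
    act_coact_of_coinvariant E g M _ (M.coinvι_condition g)]
  rfl

/-- By flatness, M^C ⊗_B A is an equalizer; the Galois isomorphisms carry its parallel pair to ν ⊗ C
and M ⊗ δ, which ν equalizes. Lifting ν through this equalizer gives the inverse of the counit. -/
theorem isIso_counit (hflat : IsLeftFlat (restrictLeft (coinvIncl E g)))
    (hg : ∀ N : RightMod A, IsIso (galoisMap E g N)) :
    IsIso (inducedDesc g (𝟙 (M.coinvMod g))) := by
  have : PreservesLimitsOfShape WalkingParallelPair
    (relFunctor (restrictLeft (coinvIncl E g))) := hflat
  have hl := isLimitForkMapOfIsLimit (relFunctor (restrictLeft (coinvIncl E g))) _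
    (M.isLimitCoinvHom g)
  have := hg M.toRightMod
  have := hg (EntwinedModule.cofree E M.toRightMod).toRightMod
  have : IsIso (galoisHom E g M.toRightMod).hom := hg M.toRightMod
  have := RightMod.isIso_of_isIso_hom (galoisHom E g M.toRightMod)
  -- The coaction read through M ⊗ C ≅ M ⊗_B A. It is taken in A-modules, where the flatness
  -- hypothesis provides the equalizer.
  let k := M.coactHom ≫ inv (galoisHom E g M.toRightMod)
  have hk : k.hom ≫ galoisMap E g M.toRightMod = M.coact :=
    congr(RightMod.Hom.hom $(show k ≫ galoisHom E g M.toRightMod = M.coactHom by simp [k]))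
  -- After composing with the Galois map of M ⊗ C, this is coassociativity of ν.
  have hk2 : k ≫ (relFunctor _).map (RightMod.restrictMap (coinvIncl E g) M.coactHom) =
      k ≫ (relFunctor _).map (tensorGroupLikeHom E g M.toRightMod) := by
    apply RightMod.hom_ext
    have h1 := galoisMap_naturality E g M.coactHom
    have h2 := galoisMap_cofree E g M.toRightMod
    change k.hom ≫ relMap (RightMod.restrictMap (coinvIncl E g) M.coactHom) _ =
      k.hom ≫ relMap (tensorGroupLikeHom E g M.toRightMod) _
    rw [← cancel_mono (galoisMap E g (EntwinedModule.cofree E M.toRightMod).toRightMod)]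
    refine (Category.assoc _ _ _).trans (Eq.trans ?_ (Category.assoc _ _ _).symm)
    refine congr(k.hom ≫ $h1).trans (Eq.trans ?_ congr(k.hom ≫ $(h2.symm)))
    rw [reassoc_of% hk, reassoc_of% hk, EntwinedModule.coactHom_hom]
    have h3 := M.coact_comul
    have h4 := congr($h3 ≫ (α_ M.X C.X C.X).inv)
    simp only [Category.assoc, Iso.hom_inv_id, Category.comp_id] at h4
    exact h4.symm
  let l : M.toRightMod ⟶ relMod (M.coinvMod g) (restrictLeft (coinvIncl E g)) :=
    Fork.IsLimit.lift hl k hk2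
  have hl1 : l ≫ (relFunctor _).map (M.coinvHom g) = k := Fork.IsLimit.lift_ι hl
  have hl2 : l.hom ≫ relMap (M.coinvHom g) (𝟙 (restrictLeft (coinvIncl E g))) = k.hom :=
    congr(RightMod.Hom.hom $hl1)
  have hd := inducedDesc_id_coact g M
  -- Tested after the monomorphism ν.
  have h1 : l.hom ≫ (inducedDesc g (𝟙 (M.coinvMod g))).hom = 𝟙 M.X := by
    rw [← cancel_mono M.coact, Category.assoc, hd, reassoc_of% hl2, hk, Category.id_comp]
  -- Tested after the equalizer inclusion into M ⊗_B A followed by the Galois map: both sides become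
  -- the counit followed by ν.
  have h2 : (inducedDesc g (𝟙 (M.coinvMod g))).hom ≫ l.hom = 𝟙 _ := by
    have h3 : (EntwinedModule.forget E).map (inducedDesc g (𝟙 (M.coinvMod g))) ≫ l = 𝟙 _ := by
      apply Fork.IsLimit.hom_ext hl
      apply RightMod.hom_ext
      change ((inducedDesc g (𝟙 (M.coinvMod g))).hom ≫ l.hom) ≫
        relMap (M.coinvHom g) (𝟙 (restrictLeft (coinvIncl E g))) =
          𝟙 _ ≫ relMap (M.coinvHom g) (𝟙 (restrictLeft (coinvIncl E g)))
      rw [Category.assoc, hl2, ← cancel_mono (galoisMap E g M.toRightMod), Category.assoc, hk, hd,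
        Category.id_comp]
    exact congr(RightMod.Hom.hom $h3)
  have : IsIso (inducedDesc g (𝟙 (M.coinvMod g))).hom := ⟨l.hom, h2, h1⟩
  exact EntwinedModule.isIso_of_isIso_hom _

end Counit

/-! ### Conservativity, and equivalences from adjunctions. -/

section Equivalence

/-- The functor - ⊗_B A is the induced functor followed by U. One direction needs only that U
preserves isomorphisms, the other that U reflects them. -/
theorem relFunctor_reflectsIsomorphisms_iff :
    (relFunctor (restrictLeft (coinvIncl E g))).ReflectsIsomorphisms ↔
      (inducedFunctor E g).ReflectsIsomorphisms := by
  have h : relFunctor (restrictLeft (coinvIncl E g)) =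
    inducedFunctor E g ⋙ EntwinedModule.forget E := rfl
  constructor
  · intro hr
    refine ⟨fun f hf => ?_⟩
    have : IsIso ((relFunctor (restrictLeft (coinvIncl E g))).map f) :=
      inferInstanceAs (IsIso ((EntwinedModule.forget E).map ((inducedFunctor E g).map f)))
    exact isIso_of_reflects_iso f (relFunctor (restrictLeft (coinvIncl E g)))
  · intro hr
    rw [h]
    infer_instance

/-- An adjunction with invertible counit and conservative left adjoint is an equivalence. -/
theorem isEquivalence_of_isIso_counit {D D' : Type*} [Category* D] [Category* D'] {F : D ⥤ D'}
    {G : D' ⥤ D} (adj : F ⊣ G) [F.ReflectsIsomorphisms] [∀ Y, IsIso (adj.counit.app Y)] :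
    F.IsEquivalence := by
  have : ∀ X, IsIso (adj.unit.app X) := fun X => by
    -- The triangle identity makes F of the unit the inverse of an invertible counit component; F
    -- then reflects this.
    have h := adj.left_triangle_components X
    have : IsIso (F.map (adj.unit.app X)) := by
      rw [← IsIso.eq_comp_inv, Category.id_comp] at h
      rw [h]
      infer_instance
    exact isIso_of_reflects_iso _ F
  exact adj.toEquivalence.isEquivalence_functor

end Equivalence

/-! ### can as a component of the counit. -/

section Converse

variable [∀ X : V, PreservesColimitsOfShape WalkingParallelPair (tensorLeft X)]

/-- Under A ≅ (A ⊗ C)^C, a ↦ a ⊗ g, the counit at A ⊗ C sends a ⊗ a' to (a ⊗ g)a' = a g_A(a'), which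
is can. -/
theorem canMor_eq_counit :
    canMor E g = relMap (cofreeCoinvLift E g (.regular A)) (𝟙 (restrictLeft (coinvIncl E g))) ≫
      (inducedDesc g (𝟙 ((EntwinedModule.cofree E (.regular A)).coinvMod g))).hom := by
  apply rel_ext
  refine (sweedlerπ_can E g).trans ?_
  have h := relπ_map (cofreeCoinvLift E g (.regular A)) (𝟙 (restrictLeft (coinvIncl E g)))
  rw [reassoc_of% h, relπ_inducedDesc, Bimod.id_hom', tensorHom_id, ← comp_whiskerRight_assoc,
    RightMod.id_hom, Category.id_comp, cofreeCoinvLift_ι]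
  exact (tensorGroupLike_act E g (.regular A)).symm

theorem isIso_canMor_of_isEquivalence [(inducedFunctor E g).IsEquivalence] :
    IsIso (canMor E g) := by
  have h1 := inducedAdj_counit (E := E) g (EntwinedModule.cofree E (.regular A))
  have h2 : IsIso (inducedAdj E g).counit := inferInstance
  have h3 : IsIso (inducedDesc g (𝟙 ((EntwinedModule.cofree E (.regular A)).coinvMod g))) := by
    rw [← h1]
    exact NatIso.isIso_app_of_isIso _ _
  have h4 := EntwinedModule.isIso_hom
    (inducedDesc g (𝟙 ((EntwinedModule.cofree E (.regular A)).coinvMod g)))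
  -- The image of an isomorphism of B-modules under - ⊗_B A.
  have h5 : IsIso (relMap (cofreeCoinvLift E g (.regular A))
      (𝟙 (restrictLeft (coinvIncl E g)))) :=
    RightMod.isIso_hom
      ((relFunctor (restrictLeft (coinvIncl E g))).map (cofreeCoinvLift E g (.regular A)))
  rw [canMor_eq_counit]
  exact IsIso.comp_isIso' h5 h4

end Converse

end GaloisEquivalence

end Entwining

/-! ### The equivalence theorem. -/

theorem theorem5p6 {V : Type u} [Category.{v} V] [MonoidalCategory V]
    [HasEqualizers V] [HasCoequalizers V]
    [∀ X : V, PreservesColimitsOfShape WalkingParallelPair (tensorLeft X)]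
    [∀ X : V, PreservesColimitsOfShape WalkingParallelPair (tensorRight X)]
    {C : Comon V} {A : Mon V} (E : Entwining.EntwiningStructure C A)
    (g : Entwining.GroupLike C) (hC : Entwining.IsFlatObj C.X) :
    (Entwining.inducedFunctor E g).IsEquivalence ↔
      Entwining.IsGalois E g ∧
        Entwining.IsLeftFaithfullyFlat
          (Entwining.restrictLeft (Entwining.coinvIncl E g)) := by
  have : PreservesLimitsOfShape WalkingParallelPair (tensorRight C.X) := hC
  constructor
  · intro hF
    have := Entwining.isIso_canMor_of_isEquivalence E g
    refine ⟨Entwining.isGalois_of_isIso_canMor E g,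
      (Entwining.relFunctor_reflectsIsomorphisms_iff E g).2 inferInstance, ?_⟩
    -- Flatness of C enters here: an equivalence preserves equalizers, U does so for flat C, and
    -- their composite is - ⊗_B A by definition.
    exact inferInstanceAs (PreservesLimitsOfShape WalkingParallelPair
      (Entwining.inducedFunctor E g ⋙ Entwining.EntwinedModule.forget E))
  · rintro ⟨hG, hr, hflat⟩
    have := Entwining.isIso_canMor_of_isGalois E g hG
    have := (Entwining.relFunctor_reflectsIsomorphisms_iff E g).1 hr
    have : ∀ M, IsIso ((Entwining.inducedAdj E g).counit.app M) := fun M => by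
      rw [Entwining.inducedAdj_counit]
      exact Entwining.isIso_counit g M hflat (Entwining.galoisMap_isIso E g)
    exact Entwining.isEquivalence_of_isIso_counit (Entwining.inducedAdj E g)
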